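/- All manifolds are smooth, Hausdorff and second countable. Let $(N,J,h)$ be a $2n$-dimensional holomorphic complex Riemannian manifold: $J$ is a smooth almost complex structure on $N$, $h$ is a smooth pseudo-Riemannian metric of signature $(n,n)$ with $h(JX,JY)=-h(X,Y)$, and $\nabla^hJ=0$ for the Levi-Civita connection $\nabla^h$ of $h$. Put $\tilde h(X,Y)=h(JX,Y)$. An almost contact complex Riemannian manifold $(M,\varphi,\xi,\eta,g)$ of dimension $2n+1$ consists of a smooth endomorphism field $\varphi$ of $TM$, a smooth vector field $\xi$, a smooth $1$-form $\eta$ and a smooth pseudo-Riemannian metric $g$ of signature $(n+1,n)$ such that $\varphi\xi=0$, $\varphi^2=-\mathrm{Id}+\eta\otimes\xi$, $\eta\circ\varphi=0$, $\eta(\xi)=1$ and $g(\varphi x,\varphi y)=-g(x,y)+\eta(x)\eta(y)$. With the Levi-Civita connection $\nabla$ of $g$ put $F(x,y,z)=g((\nabla_x\varphi)y,z)$. The manifold is called Sasaki-like if $F(X,Y,Z)=F(\xi,Y,Z)=F(\xi,\xi,Z)=0$ and $F(X,Y,\xi)=-g(X,Y)$ for all $X,Y,Z\in H=\ker\eta$.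 (1) The product $\mathbb R^+\times N$, with $t$ the coordinate on $\mathbb R^+=(0,\infty)$ and with $$\eta=dt,\qquad \xi=\tfrac{\partial}{\partial t},\qquad \varphi\xi=0,\qquad \varphi|_H=J,\qquad g=dt^2+\cos 2t\; h-\sin 2t\;\tilde h,$$ is a Sasaki-like almost contact complex Riemannian manifold of dimension $2n+1$. (2) If $N$ is compact, then for every integer $k\ge 1$, with $S^1=\mathbb R/k\pi\mathbb Z$ (the standard circle $\mathbb R/2\pi\mathbb Z$ being the case $k=2$), the manifold $S^1\times N$ is compact, and the structure of (1) descends along $(t,p)\mapsto([t],p)$ to $S^1\times N$: there are tensor fields $(\varphi,\xi,\eta,g)$ on $S^1\times N$ to which the structure of (1) is related by this map ($\eta$ and $g$ pull back to those of (1), and $\varphi$, $\xi$ are related to those of (1) by its differential), and they make $S^1\times N$ a Sasaki-like almost contact complex Riemannian manifold of dimension $2n+1$. -/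

import Mathlib

open Bundle Manifold ContDiff

noncomputable section

namespace SasakiLike

section Tensors

variable {E : Type*} [NormedAddCommGroup E] [NormedSpace ℝ E]
  {H : Type*} [TopologicalSpace H] (I : ModelWithCorners ℝ E H)
  (M : Type*) [TopologicalSpace M] [ChartedSpace H M]

/-- A field of endomorphisms of the tangent spaces, i.e. a (not necessarily smooth) tensor field of
type (1,1). -/
abbrev EndField : Type _ := Π x : M, TangentSpace I x →L[ℝ] TangentSpace I x

/-- A field of linear forms on the tangent spaces, i.e. a (not necessarily smooth) 1-form. -/
abbrev FormField : Type _ := Π x : M, TangentSpace I x →L[ℝ] ℝ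

/-- A field of bilinear forms on the tangent spaces, i.e. a (not necessarily smooth) tensor field
of type (0,2). -/
abbrev BilinField : Type _ := Π x : M, TangentSpace I x →L[ℝ] TangentSpace I x →L[ℝ] ℝ

/-- A vector field (not necessarily smooth). -/
abbrev VecField : Type _ := Π x : M, TangentSpace I x

end Tensors

section Definitions

variable {E : Type*} [NormedAddCommGroup E] [NormedSpace ℝ E]
  {H : Type*} [TopologicalSpace H] {I : ModelWithCorners ℝ E H}
  {M : Type*} [TopologicalSpace M] [ChartedSpace H M] [IsManifold I ∞ M]

/-- Smoothness of a vector field, as a section of the tangent bundle. -/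
def SmoothVec (ξ : VecField I M) : Prop :=
  ContMDiff I (I.prod 𝓘(ℝ, E)) ∞ (fun x => TotalSpace.mk' E x (ξ x))

/-- Smoothness of a 1-form, as a section of the bundle `Hom(TM, ℝ)`. -/
def SmoothForm (η : FormField I M) : Prop :=
  ContMDiff I (I.prod 𝓘(ℝ, E →L[ℝ] ℝ)) ∞
    (fun x => TotalSpace.mk' (E →L[ℝ] ℝ) (E := fun x : M => TangentSpace I x →L[ℝ] ℝ) x (η x))

/-- Smoothness of a field of endomorphisms, as a section of the bundle `Hom(TM, TM)`. -/
def SmoothEnd (φ : EndField I M) : Prop :=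
  ContMDiff I (I.prod 𝓘(ℝ, E →L[ℝ] E)) ∞
    (fun x => TotalSpace.mk' (E →L[ℝ] E)
      (E := fun x : M => TangentSpace I x →L[ℝ] TangentSpace I x) x (φ x))

/-- Smoothness of a field of bilinear forms, as a section of the bundle `Hom(TM, Hom(TM, ℝ))`. -/
def SmoothBilin (g : BilinField I M) : Prop :=
  ContMDiff I (I.prod 𝓘(ℝ, E →L[ℝ] E →L[ℝ] ℝ)) ∞
    (fun x => TotalSpace.mk' (E →L[ℝ] E →L[ℝ] ℝ)
      (E := fun x : M => TangentSpace I x →L[ℝ] TangentSpace I x →L[ℝ] ℝ) x (g x))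

/-- A smooth pseudo-Riemannian metric of signature `(p, q)`: a smooth field of symmetric bilinear
forms such that every tangent space has a basis which is orthonormal with `p` vectors of square `1`
and `q` vectors of square `-1`. (In particular the forms are nondegenerate and the manifold has
dimension `p + q`.) -/
structure IsPseudoRiemannianMetric (p q : ℕ) (g : BilinField I M) : Prop where
  smooth : SmoothBilin g
  symm : ∀ (x : M) (u v : TangentSpace I x), g x u v = g x v u
  signature : ∀ x : M, ∃ e : Module.Basis (Fin p ⊕ Fin q) ℝ (TangentSpace I x),
    (∀ i j, i ≠ j → g x (e i) (e j) = 0) ∧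
    (∀ i : Fin p, g x (e (Sum.inl i)) (e (Sum.inl i)) = 1) ∧
    (∀ j : Fin q, g x (e (Sum.inr j)) (e (Sum.inr j)) = -1)

/-- `∇` is the Levi-Civita connection of the pseudo-Riemannian metric `g`: it is torsion-free,
`∇_X Y - ∇_Y X = [X, Y]`, and metric, `u (g(Y, Z)) = g(∇_u Y, Z) + g(Y, ∇_u Z)`.
(In Mathlib `∇ Y x u` stands for the vector `∇_u Y` at `x`. By nondegeneracy of `g`, the values of
such a connection on differentiable vector fields are uniquely determined by `g`.) -/
structure IsLeviCivita [FiniteDimensional ℝ E] (g : BilinField I M)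
    (nabla : CovariantDerivative I E (TangentSpace I : M → Type _)) : Prop where
  torsion_free : ∀ (X Y : VecField I M) (x : M), MDiffAt (T% X) x → MDiffAt (T% Y) x →
    nabla Y x (X x) - nabla X x (Y x) = VectorField.mlieBracket I X Y x
  metric : ∀ (Y Z : VecField I M) (x : M), MDiffAt (T% Y) x → MDiffAt (T% Z) x →
    ∀ u : TangentSpace I x,
      mvfderiv I (fun y => g y (Y y) (Z y)) x u =
        g x (nabla Y x u) (Z x) + g x (Y x) (nabla Z x u)

/-- The covariant derivative of a field `φ` of endomorphisms:
`(∇_u φ) Y = ∇_u (φ Y) - φ (∇_u Y)` at the point `x`, for `u` in the tangent space at `x` and a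
vector field `Y`. For differentiable `φ` and `Y` it depends only on the value of `Y` at `x`. -/
def nablaEnd (nabla : CovariantDerivative I E (TangentSpace I : M → Type _)) (φ : EndField I M)
    (Y : VecField I M) (x : M) (u : TangentSpace I x) : TangentSpace I x :=
  nabla (fun y => φ y (Y y)) x u - φ x (nabla Y x u)

/-- `(M, J, h)` is a holomorphic complex Riemannian manifold of real dimension `2n`:
`J` is a smooth almost complex structure, `h` is a smooth pseudo-Riemannian metric of neutral
signature `(n, n)`, `J` is an anti-isometry of `h`, and `J` is parallel with respect to the
Levi-Civita connection of `h`. -/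
structure IsHolomorphicComplexRiemannian [FiniteDimensional ℝ E] (n : ℕ)
    (J : EndField I M) (h : BilinField I M) : Prop where
  smooth_J : SmoothEnd J
  J_sq : ∀ (x : M) (u : TangentSpace I x), J x (J x u) = -u
  metric : IsPseudoRiemannianMetric n n h
  anti_isometry : ∀ (x : M) (u v : TangentSpace I x), h x (J x u) (J x v) = -h x u v
  parallel : ∃ nabla : CovariantDerivative I E (TangentSpace I : M → Type _),
    IsLeviCivita h nabla ∧
    ∀ (Y : VecField I M) (x : M), MDiffAt (T% Y) x →
      ∀ u : TangentSpace I x, nablaEnd nabla J Y x u = 0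

end Definitions

section Contact

variable {E : Type*} [NormedAddCommGroup E] [NormedSpace ℝ E]
  {H : Type*} [TopologicalSpace H] (I : ModelWithCorners ℝ E H)
  (M : Type*) [TopologicalSpace M] [ChartedSpace H M]

/-- The four tensor fields `(φ, ξ, η, g)` on a manifold; no condition is imposed here. -/
structure ContactTensors where
  φ : EndField I M
  ξ : VecField I M
  η : FormField I M
  g : BilinField I M

variable {I M}

/-- `(M, φ, ξ, η, g)` is an almost contact complex Riemannian manifold of dimension `2n+1`:
`(φ, ξ, η)` is an almost contact structure and `g` is a pseudo-Riemannian metric of signature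
`(n+1, n)` such that `g(φ u, φ v) = -g(u, v) + η(u) η(v)`. -/
structure IsAlmostContactComplexRiemannian [IsManifold I ∞ M] (n : ℕ)
    (S : ContactTensors I M) : Prop where
  smooth_φ : SmoothEnd S.φ
  smooth_ξ : SmoothVec S.ξ
  smooth_η : SmoothForm S.η
  φ_ξ : ∀ x : M, S.φ x (S.ξ x) = 0
  φ_sq : ∀ (x : M) (u : TangentSpace I x), S.φ x (S.φ x u) = -u + S.η x u • S.ξ x
  η_φ : ∀ (x : M) (u : TangentSpace I x), S.η x (S.φ x u) = 0
  η_ξ : ∀ x : M, S.η x (S.ξ x) = 1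
  metric : IsPseudoRiemannianMetric (n + 1) n S.g
  compatible : ∀ (x : M) (u v : TangentSpace I x),
    S.g x (S.φ x u) (S.φ x v) = -S.g x u v + S.η x u * S.η x v

/-- The structure tensor `F(u, Y, w) = g((∇_u φ) Y, w)` at the point `x`. -/
def fundamentalTensor [IsManifold I ∞ M] (S : ContactTensors I M)
    (nabla : CovariantDerivative I E (TangentSpace I : M → Type _))
    (x : M) (u : TangentSpace I x) (Y : VecField I M) (w : TangentSpace I x) : ℝ :=
  S.g x (nablaEnd nabla S.φ Y x u) w

/-- An almost contact complex Riemannian manifold `(M, φ, ξ, η, g)` of dimension `2n+1` is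
*Sasaki-like* if, with `F` formed by means of the Levi-Civita connection of `g`,
`F(X,Y,Z) = F(ξ,Y,Z) = F(ξ,ξ,Z) = 0` and `F(X,Y,ξ) = -g(X,Y)` for all horizontal `X, Y, Z`, that is,
for `X, Y, Z` in the kernel of `η`. -/
structure IsSasakiLike [FiniteDimensional ℝ E] [IsManifold I ∞ M] (n : ℕ)
    (S : ContactTensors I M) : Prop extends IsAlmostContactComplexRiemannian n S where
  sasaki : ∃ nabla : CovariantDerivative I E (TangentSpace I : M → Type _),
    IsLeviCivita S.g nabla ∧
    (∀ (x : M) (Y : VecField I M), MDiffAt (T% Y) x → S.η x (Y x) = 0 →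
      (∀ u w : TangentSpace I x, S.η x u = 0 → S.η x w = 0 →
        fundamentalTensor S nabla x u Y w = 0) ∧
      (∀ w : TangentSpace I x, S.η x w = 0 →
        fundamentalTensor S nabla x (S.ξ x) Y w = 0) ∧
      (∀ u : TangentSpace I x, S.η x u = 0 →
        fundamentalTensor S nabla x u Y (S.ξ x) = -S.g x u (Y x))) ∧
    (∀ (x : M) (w : TangentSpace I x), S.η x w = 0 →
      fundamentalTensor S nabla x (S.ξ x) S.ξ w = 0)

/-- The tensors `S'` on `M'` descend along `f : M' → M` to the tensors `S` on `M`: at every point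
of `M'` the covariant tensors of `S'` are the pull-backs of those of `S`, and `φ`, `ξ` are
`f`-related. -/
structure DescendsTo {E' : Type*} [NormedAddCommGroup E'] [NormedSpace ℝ E']
    {H' : Type*} [TopologicalSpace H'] {I' : ModelWithCorners ℝ E' H'}
    {M' : Type*} [TopologicalSpace M'] [ChartedSpace H' M']
    (S' : ContactTensors I' M') (f : M' → M) (S : ContactTensors I M) : Prop where
  φ : ∀ (q : M') (u : TangentSpace I' q),
    mfderiv I' I f q (S'.φ q u) = S.φ (f q) (mfderiv I' I f q u)
  ξ : ∀ q : M', mfderiv I' I f q (S'.ξ q) = S.ξ (f q)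
  η : ∀ (q : M') (u : TangentSpace I' q), S'.η q u = S.η (f q) (mfderiv I' I f q u)
  g : ∀ (q : M') (u v : TangentSpace I' q),
    S'.g q u v = S.g (f q) (mfderiv I' I f q u) (mfderiv I' I f q v)

end Contact

section Extension

variable {E : Type*} [NormedAddCommGroup E] [NormedSpace ℝ E]
  {N : Type*} [TopologicalSpace N] [ChartedSpace E N]

/-- The half-line of positive reals, as an open subset of the manifold `ℝ`. -/
abbrev PosReal : TopologicalSpace.Opens ℝ := ⟨Set.Ioi (0 : ℝ), isOpen_Ioi⟩

/-- The model with corners of `ℝ⁺ × N`, for `N` modelled on `E`. -/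
abbrev prodModel (E : Type*) [NormedAddCommGroup E] [NormedSpace ℝ E] :
    ModelWithCorners ℝ (ℝ × E) (ModelProd ℝ E) :=
  𝓘(ℝ, ℝ).prod 𝓘(ℝ, E)

/-- The 1-form `dt` on `ℝ⁺ × N`, where `t` is the coordinate of the first factor. -/
def dt : FormField (prodModel E) (PosReal × N) := fun q =>
  mvfderiv (prodModel E) (fun r : PosReal × N => (r.1 : ℝ)) q

/-- The vector field `∂/∂t` on `ℝ⁺ × N`: the velocity of `s ↦ (s, p)` at `s = t`. (The tangent space
of `ℝ⁺` is `ℝ`, the chart of `ℝ⁺` being the inclusion into `ℝ`.) -/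
def partialT : VecField (prodModel E) (PosReal × N) := fun q =>
  mfderiv 𝓘(ℝ, ℝ) (prodModel E) (fun s : PosReal => (s, q.2)) q.1
    (show TangentSpace 𝓘(ℝ, ℝ) q.1 from (1 : ℝ))

/-- The differential at `q` of the projection `ℝ⁺ × N → N`. -/
def dproj (q : PosReal × N) :
    TangentSpace (prodModel E) q →L[ℝ] TangentSpace 𝓘(ℝ, E) q.2 :=
  mfderiv (prodModel E) 𝓘(ℝ, E) (Prod.snd : PosReal × N → N) q

/-- The differential at `q.2` of the inclusion `p ↦ (q.1, p)` of the slice through `q`; its range is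
the horizontal space, the kernel of `dt`. -/
def dslice (q : PosReal × N) :
    TangentSpace 𝓘(ℝ, E) q.2 →L[ℝ] TangentSpace (prodModel E) q :=
  mfderiv 𝓘(ℝ, E) (prodModel E) (fun p : N => ((q.1, p) : PosReal × N)) q.2

/-- The associated form `h̃(X, Y) = h(J X, Y)`. -/
def associated (J : EndField 𝓘(ℝ, E) N) (h : BilinField 𝓘(ℝ, E) N) : BilinField 𝓘(ℝ, E) N :=
  fun p => (h p).comp (J p)

/-- The pull-back to `ℝ⁺ × N` of a field of bilinear forms on `N`: `(u, v) ↦ h(dπ u, dπ v)`, where `π` is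
the projection to `N`. (The tangent spaces of `N` and of `ℝ⁺ × N` are `E` and `ℝ × E`.) -/
def pullbackBilin (h : BilinField 𝓘(ℝ, E) N) : BilinField (prodModel E) (PosReal × N) :=
  fun q =>
    let b : E →L[ℝ] E →L[ℝ] ℝ := h q.2
    let A : ℝ × E →L[ℝ] E := dproj q
    b.bilinearComp A A

/-- The structure on `ℝ⁺ × N` with `η = dt`, `ξ = ∂/∂t`, `φ = J` on the horizontal spaces, `φ ξ = 0`,
and `g = dt² + cos 2t · h - sin 2t · h̃`. -/
def solvableExtension (J : EndField 𝓘(ℝ, E) N) (h : BilinField 𝓘(ℝ, E) N) :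
    ContactTensors (prodModel E) (PosReal × N) where
  φ q := (dslice q).comp ((J q.2).comp (dproj q))
  ξ := partialT
  η := dt
  g q := (dt q).smulRight (dt q) + Real.cos (2 * (q.1 : ℝ)) • pullbackBilin h q
    - Real.sin (2 * (q.1 : ℝ)) • pullbackBilin (associated J h) q

/-- The map `ℝ⁺ × N → S¹ × N`, `(t, p) ↦ (exp(2it/k), p)`. Since `t ↦ exp(2it/k)` induces an
isomorphism of `ℝ/kπℤ` with the unit circle, it is the projection onto `(ℝ/kπℤ) × N`; for `k = 2`
it is `(t, p) ↦ (exp(it), p)`. -/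
def circleProj (N : Type*) (k : ℕ) (q : PosReal × N) : Circle × N :=
  (Circle.exp (2 * (q.1 : ℝ) / k), q.2)

end Extension

end SasakiLike

end

noncomputable section

namespace SasakiLike

section Bracket

variable {E : Type*} [NormedAddCommGroup E] [NormedSpace ℝ E]
  {H : Type*} [TopologicalSpace H] {I : ModelWithCorners ℝ E H}
  {M : Type*} [TopologicalSpace M] [ChartedSpace H M]
  {F : Type*} [NormedAddCommGroup F] [NormedSpace ℝ F]

/-- The tangent space at a point, identified with the model vector space by means of the preferred
chart at this point. -/
def tangentModel (I : ModelWithCorners ℝ E H) (x : M) : TangentSpace I x ≃L[ℝ] E :=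
  ContinuousLinearEquiv.refl ℝ E

theorem mvfderiv_extChartAt_self [I.Boundaryless] [IsManifold I 1 M] (x : M) :
    mvfderiv I (extChartAt I x) x = (tangentModel I x : TangentSpace I x →L[ℝ] E) := by
  have h := (mdifferentiableAt_extChartAt (I := I) (x := x) (y := x)
    (mem_chart_source H x)).mvfderiv
  rw [h, I.range_eq_univ, fderivWithin_univ]
  have h2 : writtenInExtChartAt I 𝓘(ℝ, E) x (extChartAt I x) =ᶠ[nhds (extChartAt I x x)] id := by
    filter_upwards [extChartAt_target_mem_nhds (I := I) x] with y hy
    exact (extChartAt I x).right_inv hy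
  rw [h2.fderiv_eq, fderiv_id]
  rfl

/-- The derivative of a vector-valued function is its derivative in the preferred chart. -/
theorem mvfderiv_eq_fderiv [I.Boundaryless] {f : M → F} {x : M} (hf : MDiffAt f x) :
    mvfderiv I f x =
      (fderiv ℝ (f ∘ (extChartAt I x).symm) (extChartAt I x x)).comp
        (tangentModel I x : TangentSpace I x →L[ℝ] E) := by
  rw [hf.mvfderiv, I.range_eq_univ, fderivWithin_univ]
  rfl

/-- A vector field read in the preferred chart at a point. -/
def vecInChart (X : VecField I M) (x : M) : E → E :=
  VectorField.mpullbackWithin 𝓘(ℝ, E) I (extChartAt I x).symm X (Set.range I)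

theorem differentiableAt_vecInChart [I.Boundaryless] [IsManifold I 2 M] [CompleteSpace E]
    {X : VecField I M} {x : M} (hX : MDiffAt (T% X) x) :
    DifferentiableAt ℝ (vecInChart X x) (extChartAt I x x) := by
  have h : MDifferentiableWithinAt I I.tangent (fun y => (⟨y, X y⟩ : TangentBundle I M))
    Set.univ x := hX.mdifferentiableWithinAt
  have h' := h.differentiableWithinAt_mpullbackWithin_vectorField
  rw [I.range_eq_univ] at h'
  simp only [Set.preimage_univ, Set.inter_univ] at h'
  simp only [vecInChart, I.range_eq_univ]
  exact h'.differentiableAt Filter.univ_mem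

theorem fderiv_comp_symm_vecInChart [I.Boundaryless] [IsManifold I 1 M] (X : VecField I M) {x : M}
    {f : M → F} {y : E} (hy : y ∈ (extChartAt I x).target)
    (hf : MDiffAt f ((extChartAt I x).symm y)) :
    fderiv ℝ (f ∘ (extChartAt I x).symm) y (vecInChart X x y) =
      mvfderiv I f ((extChartAt I x).symm y) (X ((extChartAt I x).symm y)) := by
  have hs : MDiffAt[Set.range I] (extChartAt I x).symm y :=
    mdifferentiableWithinAt_extChartAt_symm hy
  have hc := mfderiv_comp_mfderivWithin y hf hs
    (by rw [I.range_eq_univ]; exact uniqueMDiffWithinAt_univ _)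
  have h1 : mfderivWithin 𝓘(ℝ, E) 𝓘(ℝ, F) (f ∘ (extChartAt I x).symm) (Set.range I) y =
      fderiv ℝ (f ∘ (extChartAt I x).symm) y := by
    rw [I.range_eq_univ, mfderivWithin_univ, mfderiv_eq_fderiv]
  rw [h1] at hc
  obtain ⟨e, he⟩ := isInvertible_mfderivWithin_extChartAt_symm hy
  have h2 : mfderivWithin 𝓘(ℝ, E) I (extChartAt I x).symm (Set.range I) y
      (VectorField.mpullbackWithin 𝓘(ℝ, E) I (extChartAt I x).symm X (Set.range I) y) =
      X ((extChartAt I x).symm y) := by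
    simp only [VectorField.mpullbackWithin, ← he]
    rw [ContinuousLinearMap.inverse_equiv]
    exact e.apply_symm_apply _
  have h3 := congr($hc
    (VectorField.mpullbackWithin 𝓘(ℝ, E) I (extChartAt I x).symm X (Set.range I) y))
  refine h3.trans ?_
  rw [← h2]
  rfl

theorem vecInChart_self [I.Boundaryless] [IsManifold I 1 M] (X : VecField I M) (x : M) :
    vecInChart X x (extChartAt I x x) = tangentModel I x (X x) := by
  have hd : MDiffAt (extChartAt I x) x := mdifferentiableAt_extChartAt (mem_chart_source H x)
  have h := fderiv_comp_symm_vecInChart X (x := x) (f := extChartAt I x)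
    (y := extChartAt I x x) (mem_extChartAt_target x) (by rwa [extChartAt_to_inv])
  rw [extChartAt_to_inv, mvfderiv_extChartAt_self] at h
  rw [← ContinuousLinearEquiv.coe_coe, ← h]
  have h2 : extChartAt I x ∘ (extChartAt I x).symm =ᶠ[nhds (extChartAt I x x)] id := by
    filter_upwards [extChartAt_target_mem_nhds (I := I) x] with y hy
    exact (extChartAt I x).right_inv hy
  rw [h2.fderiv_eq, fderiv_id]
  rfl

theorem tangentModel_mlieBracket [I.Boundaryless] [IsManifold I 1 M] (X Y : VecField I M) (x : M) :
    tangentModel I x (VectorField.mlieBracket I X Y x) =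
      fderiv ℝ (vecInChart Y x) (extChartAt I x x) (tangentModel I x (X x)) -
        fderiv ℝ (vecInChart X x) (extChartAt I x x) (tangentModel I x (Y x)) := by
  have h : mfderiv I 𝓘(ℝ, E) (extChartAt I x) x =
      ((tangentModel I x : TangentSpace I x ≃L[ℝ] E) : TangentSpace I x →L[ℝ] E) :=
    mvfderiv_extChartAt_self x
  rw [VectorField.mlieBracket, VectorField.mlieBracketWithin_apply]
  rw [h]
  have h2 : ∀ v : E, tangentModel I x
      (((tangentModel I x : TangentSpace I x ≃L[ℝ] E) : TangentSpace I x →L[ℝ] E).inverse v) = v := by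
    intro v
    rw [ContinuousLinearMap.inverse_equiv]
    exact (tangentModel I x).apply_symm_apply _
  refine (h2 _).trans ?_
  rw [← vecInChart_self, ← vecInChart_self]
  simp only [vecInChart, I.range_eq_univ, Set.preimage_univ, Set.univ_inter]
  exact congrFun VectorField.lieBracketWithin_univ _

theorem contDiffAt_comp_extChartAt_symm [I.Boundaryless] {n : ℕ∞ω} [IsManifold I n M] {f : M → F}
    {x : M} (hf : ContMDiffAt I 𝓘(ℝ, F) n f x) :
    ContDiffAt ℝ n (f ∘ (extChartAt I x).symm) (extChartAt I x x) := by
  have h := (contMDiffAt_iff.1 hf).2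
  rw [I.range_eq_univ, contDiffWithinAt_univ] at h
  exact h

theorem eventually_mvfderiv_apply_eq [I.Boundaryless] [IsManifold I 2 M]
    {f : M → F} {x : M} (hf : ContMDiffAt I 𝓘(ℝ, F) 2 f x) (X : VecField I M) :
    ∀ᶠ y in nhds (extChartAt I x x),
      mvfderiv I f ((extChartAt I x).symm y) (X ((extChartAt I x).symm y)) =
        fderiv ℝ (f ∘ (extChartAt I x).symm) y (vecInChart X x y) := by
  have : IsManifold I 1 M := IsManifold.of_le (n := 2) (by norm_num)
  have h1 : ∀ᶠ z in nhds x, MDiffAt f z :=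
    (contMDiffAt_iff_contMDiffAt_nhds (by simp)).1 hf |>.mono fun z hz => hz.mdifferentiableAt (by simp)
  have h2 := (continuousAt_extChartAt_symm (I := I) x).eventually
    (by rw [extChartAt_to_inv]; exact h1)
  filter_upwards [h2, extChartAt_target_mem_nhds (I := I) x] with y hy hy'
  exact (fderiv_comp_symm_vecInChart X hy' hy).symm

theorem differentiableAt_fderiv_apply_vecInChart [I.Boundaryless] [IsManifold I 2 M]
    [CompleteSpace E] {f : M → F} {x : M} (hf : ContMDiffAt I 𝓘(ℝ, F) 2 f x)
    {X : VecField I M} (hX : MDiffAt (T% X) x) :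
    DifferentiableAt ℝ (fun y => fderiv ℝ (f ∘ (extChartAt I x).symm) y (vecInChart X x y))
      (extChartAt I x x) :=
  (((contDiffAt_comp_extChartAt_symm hf).fderiv_right (m := 1) (by norm_num)).differentiableAt
    (by simp)).clm_apply (differentiableAt_vecInChart hX)

theorem mdifferentiableAt_mvfderiv_apply [I.Boundaryless] [IsManifold I 2 M]
    [CompleteSpace E] {f : M → F} {x : M} (hf : ContMDiffAt I 𝓘(ℝ, F) 2 f x)
    {X : VecField I M} (hX : MDiffAt (T% X) x) :
    MDiffAt (fun y => mvfderiv I f y (X y)) x := by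
  have : IsManifold I 1 M := IsManifold.of_le (n := 2) (by norm_num)
  have h1 := differentiableAt_fderiv_apply_vecInChart hf hX
  have h2 : MDiffAt (extChartAt I x) x := mdifferentiableAt_extChartAt (mem_chart_source H x)
  refine (h1.mdifferentiableAt.comp x h2).congr_of_eventuallyEq ?_
  have h3 := (continuousAt_extChartAt (I := I) x).eventually (eventually_mvfderiv_apply_eq hf X)
  filter_upwards [h3, extChartAt_source_mem_nhds (I := I) x] with z hz hz'
  rw [(extChartAt I x).left_inv hz'] at hz
  exact hz

/-- The Lie bracket of two differentiable vector fields acts on functions as the commutator of the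
two derivations. -/
theorem mvfderiv_mlieBracket [I.Boundaryless] [IsManifold I 2 M]
    [CompleteSpace E] {f : M → F} {x : M} (hf : ContMDiffAt I 𝓘(ℝ, F) 2 f x)
    {X Y : VecField I M} (hX : MDiffAt (T% X) x) (hY : MDiffAt (T% Y) x) :
    mvfderiv I f x (VectorField.mlieBracket I X Y x) =
      mvfderiv I (fun y => mvfderiv I f y (Y y)) x (X x) -
        mvfderiv I (fun y => mvfderiv I f y (X y)) x (Y x) := by
  have : IsManifold I 1 M := IsManifold.of_le (n := 2) (by norm_num)
  have key : ∀ {Z : VecField I M}, MDiffAt (T% Z) x → ∀ v : TangentSpace I x,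
      mvfderiv I (fun y => mvfderiv I f y (Z y)) x v =
        fderiv ℝ (fderiv ℝ (f ∘ (extChartAt I x).symm)) (extChartAt I x x) (tangentModel I x v)
          (tangentModel I x (Z x)) +
        fderiv ℝ (f ∘ (extChartAt I x).symm) (extChartAt I x x)
          (fderiv ℝ (vecInChart Z x) (extChartAt I x x) (tangentModel I x v)) := by
    intro Z hZ v
    rw [mvfderiv_eq_fderiv (mdifferentiableAt_mvfderiv_apply hf hZ)]
    have h : (fun y => mvfderiv I f y (Z y)) ∘ (extChartAt I x).symm =ᶠ[nhds (extChartAt I x x)]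
      fun y => fderiv ℝ (f ∘ (extChartAt I x).symm) y (vecInChart Z x y) :=
      eventually_mvfderiv_apply_eq hf Z
    rw [h.fderiv_eq, fderiv_clm_apply (((contDiffAt_comp_extChartAt_symm hf).fderiv_right (m := 1)
      (by norm_num)).differentiableAt (by simp)) (differentiableAt_vecInChart hZ)]
    rw [← vecInChart_self]
    simp [add_comm]
  rw [key hX, key hY, mvfderiv_eq_fderiv (hf.mdifferentiableAt (by simp)),
    ContinuousLinearMap.comp_apply, ContinuousLinearEquiv.coe_coe, tangentModel_mlieBracket,
    map_sub]
  have hs := ((contDiffAt_comp_extChartAt_symm hf).isSymmSndFDerivAt (by simp))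
    (tangentModel I x (X x)) (tangentModel I x (Y x))
  rw [hs]
  abel

end Bracket

section Product

variable {E' : Type*} [NormedAddCommGroup E'] [NormedSpace ℝ E']
  {B : Type*} [TopologicalSpace B] [ChartedSpace E' B]
  {E : Type*} [NormedAddCommGroup E] [NormedSpace ℝ E]
  {N : Type*} [TopologicalSpace N] [ChartedSpace E N]
  {F : Type*} [NormedAddCommGroup F] [NormedSpace ℝ F]

/-- The model with corners of a product of two manifolds without boundary. -/
abbrev prodModels (E' E : Type*) [NormedAddCommGroup E'] [NormedSpace ℝ E']
    [NormedAddCommGroup E] [NormedSpace ℝ E] : ModelWithCorners ℝ (E' × E) (ModelProd E' E) :=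
  𝓘(ℝ, E').prod 𝓘(ℝ, E)

/-- The differential of the projection to the first factor. -/
def tangentFst (q : B × N) : TangentSpace (prodModels E' E) q →L[ℝ] TangentSpace 𝓘(ℝ, E') q.1 :=
  mfderiv (prodModels E' E) 𝓘(ℝ, E') (Prod.fst : B × N → B) q

/-- The differential of the projection to the second factor. -/
def tangentSnd (q : B × N) : TangentSpace (prodModels E' E) q →L[ℝ] TangentSpace 𝓘(ℝ, E) q.2 :=
  mfderiv (prodModels E' E) 𝓘(ℝ, E) (Prod.snd : B × N → N) q

/-- The differential of the inclusion of a horizontal slice. -/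
def tangentInl (q : B × N) : TangentSpace 𝓘(ℝ, E') q.1 →L[ℝ] TangentSpace (prodModels E' E) q :=
  mfderiv 𝓘(ℝ, E') (prodModels E' E) (fun s : B => (s, q.2)) q.1

/-- The differential of the inclusion of a vertical slice. -/
def tangentInr (q : B × N) : TangentSpace 𝓘(ℝ, E) q.2 →L[ℝ] TangentSpace (prodModels E' E) q :=
  mfderiv 𝓘(ℝ, E) (prodModels E' E) (fun p : N => (q.1, p)) q.2

theorem tangentFst_eq (q : B × N) :
    tangentFst (E' := E') (E := E) q = ContinuousLinearMap.fst ℝ E' E :=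
  mfderiv_fst

theorem tangentSnd_eq (q : B × N) :
    tangentSnd (E' := E') (E := E) q = ContinuousLinearMap.snd ℝ E' E :=
  mfderiv_snd

theorem tangentInl_eq (q : B × N) :
    tangentInl (E' := E') (E := E) q = ContinuousLinearMap.inl ℝ E' E :=
  mfderiv_prod_left

theorem tangentInr_eq (q : B × N) :
    tangentInr (E' := E') (E := E) q = ContinuousLinearMap.inr ℝ E' E :=
  mfderiv_prod_right

@[simp]
theorem tangentFst_inl (q : B × N) (a : TangentSpace 𝓘(ℝ, E') q.1) :
    tangentFst (E := E) q (tangentInl q a) = a := by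
  rw [tangentFst_eq, tangentInl_eq]; rfl

@[simp]
theorem tangentFst_inr (q : B × N) (a : TangentSpace 𝓘(ℝ, E) q.2) :
    tangentFst (E' := E') q (tangentInr q a) = 0 := by
  rw [tangentFst_eq, tangentInr_eq]; rfl

@[simp]
theorem tangentSnd_inl (q : B × N) (a : TangentSpace 𝓘(ℝ, E') q.1) :
    tangentSnd (E := E) q (tangentInl q a) = 0 := by
  rw [tangentSnd_eq, tangentInl_eq]; rfl

@[simp]
theorem tangentSnd_inr (q : B × N) (a : TangentSpace 𝓘(ℝ, E) q.2) :
    tangentSnd (E' := E') q (tangentInr q a) = a := by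
  rw [tangentSnd_eq, tangentInr_eq]; rfl

theorem tangentInl_fst_add_inr_snd (q : B × N) (u : TangentSpace (prodModels E' E) q) :
    tangentInl q (tangentFst q u) + tangentInr q (tangentSnd q u) = u := by
  rw [tangentFst_eq, tangentInl_eq, tangentSnd_eq, tangentInr_eq]
  exact Prod.ext (add_zero _) (zero_add _)

theorem tangent_prod_ext {q : B × N} {u v : TangentSpace (prodModels E' E) q}
    (h₁ : tangentFst q u = tangentFst q v) (h₂ : tangentSnd q u = tangentSnd q v) : u = v := by
  rw [← tangentInl_fst_add_inr_snd q u, h₁, h₂, tangentInl_fst_add_inr_snd]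

theorem mdifferentiableAt_slice_left (q : B × N) :
    MDifferentiableAt 𝓘(ℝ, E') (prodModels E' E) (fun s : B => (s, q.2)) q.1 :=
  mdifferentiableAt_id.prodMk mdifferentiableAt_const

theorem mdifferentiableAt_slice_right (q : B × N) :
    MDifferentiableAt 𝓘(ℝ, E) (prodModels E' E) (fun p : N => (q.1, p)) q.2 :=
  mdifferentiableAt_const.prodMk mdifferentiableAt_id

theorem mvfderiv_tangentInl {f : B × N → F} {q : B × N}
    (hf : MDifferentiableAt (prodModels E' E) 𝓘(ℝ, F) f q) (a : TangentSpace 𝓘(ℝ, E') q.1) :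
    mvfderiv (prodModels E' E) f q (tangentInl q a) =
      mvfderiv 𝓘(ℝ, E') (fun s => f (s, q.2)) q.1 a :=
  (mfderiv_comp_apply (I' := prodModels E' E) q.1 (g := f) hf
    (mdifferentiableAt_slice_left q) a).symm

theorem mvfderiv_tangentInr {f : B × N → F} {q : B × N}
    (hf : MDifferentiableAt (prodModels E' E) 𝓘(ℝ, F) f q) (a : TangentSpace 𝓘(ℝ, E) q.2) :
    mvfderiv (prodModels E' E) f q (tangentInr q a) =
      mvfderiv 𝓘(ℝ, E) (fun p => f (q.1, p)) q.2 a :=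
  (mfderiv_comp_apply (I' := prodModels E' E) q.2 (g := f) hf
    (mdifferentiableAt_slice_right q) a).symm

theorem mvfderiv_prod_split {f : B × N → F} {q : B × N}
    (hf : MDifferentiableAt (prodModels E' E) 𝓘(ℝ, F) f q)
    (u : TangentSpace (prodModels E' E) q) :
    mvfderiv (prodModels E' E) f q u =
      mvfderiv 𝓘(ℝ, E') (fun s => f (s, q.2)) q.1 (tangentFst q u) +
        mvfderiv 𝓘(ℝ, E) (fun p => f (q.1, p)) q.2 (tangentSnd q u) := by
  rw [← mvfderiv_tangentInl hf, ← mvfderiv_tangentInr hf, ← map_add, tangentInl_fst_add_inr_snd]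

theorem mvfderiv_comp_snd {f : N → F} {q : B × N} (hf : MDifferentiableAt 𝓘(ℝ, E) 𝓘(ℝ, F) f q.2)
    (u : TangentSpace (prodModels E' E) q) :
    mvfderiv (prodModels E' E) (fun r : B × N => f r.2) q u =
      mvfderiv 𝓘(ℝ, E) f q.2 (tangentSnd q u) :=
  mfderiv_comp_apply (I' := 𝓘(ℝ, E)) q (g := f) hf mdifferentiableAt_snd u

theorem mvfderiv_comp_fst {f : B → F} {q : B × N} (hf : MDifferentiableAt 𝓘(ℝ, E') 𝓘(ℝ, F) f q.1)
    (u : TangentSpace (prodModels E' E) q) :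
    mvfderiv (prodModels E' E) (fun r : B × N => f r.1) q u =
      mvfderiv 𝓘(ℝ, E') f q.1 (tangentFst q u) :=
  mfderiv_comp_apply (I' := 𝓘(ℝ, E')) q (g := f) hf mdifferentiableAt_fst u

end Product

section PullbackSections

variable {E' : Type*} [NormedAddCommGroup E'] [NormedSpace ℝ E']
  {B : Type*} [TopologicalSpace B] [ChartedSpace E' B]
  {E : Type*} [NormedAddCommGroup E] [NormedSpace ℝ E]
  {N : Type*} [TopologicalSpace N] [ChartedSpace E N]

/-- A section of the pull-back of the tangent bundle of `N` to `B × N`. -/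
abbrev SndField (E : Type*) [NormedAddCommGroup E] [NormedSpace ℝ E] (B N : Type*)
    [TopologicalSpace N] [ChartedSpace E N] : Type _ :=
  Π q : B × N, TangentSpace 𝓘(ℝ, E) q.2

variable [IsManifold 𝓘(ℝ, E) ∞ N]

/-- Differentiability of a section of the pull-back of the tangent bundle of `N`. -/
def SndDiffAt (E' : Type*) [NormedAddCommGroup E'] [NormedSpace ℝ E'] [ChartedSpace E' B]
    (σ : SndField E B N) (q : B × N) : Prop :=
  MDifferentiableAt (prodModels E' E) 𝓘(ℝ, E).tangent
    (fun r : B × N => (⟨r.2, σ r⟩ : TangentBundle 𝓘(ℝ, E) N)) q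

theorem SndDiffAt.slice {σ : SndField E B N} {q : B × N} (h : SndDiffAt E' σ q) :
    MDifferentiableAt 𝓘(ℝ, E) 𝓘(ℝ, E).tangent
      (fun p : N => (⟨p, σ (q.1, p)⟩ : TangentBundle 𝓘(ℝ, E) N)) q.2 :=
  MDifferentiableAt.comp (I' := prodModels E' E) (f := fun p : N => (q.1, p)) q.2
    (g := fun r : B × N => (⟨r.2, σ r⟩ : TangentBundle 𝓘(ℝ, E) N)) h (mdifferentiableAt_slice_right q)

theorem SndDiffAt.curve {σ : SndField E B N} {q : B × N} (h : SndDiffAt E' σ q) :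
    MDifferentiableAt 𝓘(ℝ, E') 𝓘(ℝ, E) (fun s : B => tangentModel 𝓘(ℝ, E) q.2 (σ (s, q.2))) q.1 := by
  have h1 : MDifferentiableAt 𝓘(ℝ, E') 𝓘(ℝ, E).tangent
      (fun s : B => (⟨q.2, σ (s, q.2)⟩ : TangentBundle 𝓘(ℝ, E) N)) q.1 :=
    MDifferentiableAt.comp (I' := prodModels E' E) (f := fun s : B => (s, q.2)) q.1
      (g := fun r : B × N => (⟨r.2, σ r⟩ : TangentBundle 𝓘(ℝ, E) N)) h (mdifferentiableAt_slice_left q)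
  have h2 := ((mdifferentiableAt_totalSpace _ _).1 h1).2
  refine h2.congr_of_eventuallyEq (Filter.Eventually.of_forall fun s => ?_)
  have h3 := congr($(TangentBundle.continuousLinearMapAt_trivializationAt (I := 𝓘(ℝ, E))
    (mem_chart_source E q.2)) (σ (s, q.2)))
  refine (congr($(mvfderiv_extChartAt_self (I := 𝓘(ℝ, E)) q.2) (σ (s, q.2)))).symm.trans
    (h3.symm.trans ?_)
  exact Bundle.Trivialization.continuousLinearMapAt_apply_of_mem ℝ _
    (mem_baseSet_trivializationAt ..) _

theorem sndDiffAt_tangentSnd [IsManifold 𝓘(ℝ, E') ∞ B] {Y : VecField (prodModels E' E) (B × N)}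
    {q : B × N} (hY : MDiffAt (T% Y) q) : SndDiffAt E' (fun r => tangentSnd r (Y r)) q := by
  have h1 : ContMDiff (prodModels E' E).tangent 𝓘(ℝ, E).tangent ∞
      (tangentMap (prodModels E' E) 𝓘(ℝ, E) (Prod.snd : B × N → N)) :=
    contMDiff_snd.contMDiff_tangentMap (m := ∞) (n := ∞) (by simp)
  exact MDifferentiableAt.comp q (h1.mdifferentiableAt (by simp)) hY

theorem SndDiffAt.bilin {h : BilinField 𝓘(ℝ, E) N} (hh : SmoothBilin h) {σ ρ : SndField E B N}
    {q : B × N} (hσ : SndDiffAt E' σ q) (hρ : SndDiffAt E' ρ q) :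
    MDifferentiableAt (prodModels E' E) 𝓘(ℝ, ℝ) (fun r => h r.2 (σ r) (ρ r)) q := by
  have hb : MDifferentiableAt (prodModels E' E) (𝓘(ℝ, E).prod 𝓘(ℝ, E →L[ℝ] E →L[ℝ] ℝ))
      (fun r : B × N => TotalSpace.mk' (E →L[ℝ] E →L[ℝ] ℝ)
        (E := fun x : N => TangentSpace 𝓘(ℝ, E) x →L[ℝ] TangentSpace 𝓘(ℝ, E) x →L[ℝ] ℝ)
          r.2 (h r.2)) q :=
    (hh.mdifferentiableAt (by simp)).comp q mdifferentiableAt_snd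
  have := MDifferentiableAt.clm_bundle_apply₂ (F₃ := ℝ) (E₃ := Bundle.Trivial N ℝ) hb hσ hρ
  rw [mdifferentiableAt_totalSpace] at this
  exact this.2

theorem SndDiffAt.endo {J : EndField 𝓘(ℝ, E) N} (hJ : SmoothEnd J) {σ : SndField E B N}
    {q : B × N} (hσ : SndDiffAt E' σ q) : SndDiffAt E' (fun r => J r.2 (σ r)) q := by
  have hb : MDifferentiableAt (prodModels E' E) (𝓘(ℝ, E).prod 𝓘(ℝ, E →L[ℝ] E))
      (fun r : B × N => TotalSpace.mk' (E →L[ℝ] E)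
        (E := fun x : N => TangentSpace 𝓘(ℝ, E) x →L[ℝ] TangentSpace 𝓘(ℝ, E) x)
          r.2 (J r.2)) q :=
    (hJ.mdifferentiableAt (by simp)).comp q mdifferentiableAt_snd
  exact MDifferentiableAt.clm_bundle_apply hb hσ

end PullbackSections

section PullbackConnection

variable {E' : Type*} [NormedAddCommGroup E'] [NormedSpace ℝ E']
  {B : Type*} [TopologicalSpace B] [ChartedSpace E' B]
  {E : Type*} [NormedAddCommGroup E] [NormedSpace ℝ E]
  {N : Type*} [TopologicalSpace N] [ChartedSpace E N] [IsManifold 𝓘(ℝ, E) ∞ N]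

/-- The pull-back to `B × N` of a connection on `N`, acting on sections of the pull-back of the
tangent bundle of `N`. -/
def pullbackConnection (E' : Type*) [NormedAddCommGroup E'] [NormedSpace ℝ E'] [ChartedSpace E' B]
    (D : CovariantDerivative 𝓘(ℝ, E) E (TangentSpace 𝓘(ℝ, E) : N → Type _)) (σ : SndField E B N)
    (q : B × N) : TangentSpace (prodModels E' E) q →L[ℝ] TangentSpace 𝓘(ℝ, E) q.2 :=
  ((tangentModel 𝓘(ℝ, E) q.2).symm : E →L[ℝ] TangentSpace 𝓘(ℝ, E) q.2).comp
      ((mvfderiv 𝓘(ℝ, E') (fun s : B => tangentModel 𝓘(ℝ, E) q.2 (σ (s, q.2))) q.1).comp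
        (tangentFst q)) +
    (D (fun p => σ (q.1, p)) q.2).comp (tangentSnd q)

variable {D : CovariantDerivative 𝓘(ℝ, E) E (TangentSpace 𝓘(ℝ, E) : N → Type _)}
  {σ ρ : SndField E B N} {q : B × N}

theorem pullbackConnection_apply (u : TangentSpace (prodModels E' E) q) :
    pullbackConnection E' D σ q u =
      (tangentModel 𝓘(ℝ, E) q.2).symm
        (mvfderiv 𝓘(ℝ, E') (fun s : B => tangentModel 𝓘(ℝ, E) q.2 (σ (s, q.2))) q.1
          (tangentFst q u)) +
      D (fun p => σ (q.1, p)) q.2 (tangentSnd q u) := rfl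

theorem pullbackConnection_add (hσ : SndDiffAt E' σ q) (hρ : SndDiffAt E' ρ q) :
    pullbackConnection E' D (fun r => σ r + ρ r) q =
      pullbackConnection E' D σ q + pullbackConnection E' D ρ q := by
  ext u
  have h1 : D (fun p => σ (q.1, p) + ρ (q.1, p)) q.2 = _ :=
    D.isCovariantDerivativeOnUniv.add hσ.slice hρ.slice
  have h2 := mvfderiv_fun_add hσ.curve hρ.curve
  simp only [add_apply, pullbackConnection_apply, map_add, h1, h2]
  abel

theorem pullbackConnection_smul {f : B × N → ℝ}
    (hf : MDifferentiableAt (prodModels E' E) 𝓘(ℝ, ℝ) f q) (hσ : SndDiffAt E' σ q)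
    (u : TangentSpace (prodModels E' E) q) :
    pullbackConnection E' D (fun r => f r • σ r) q u =
      f q • pullbackConnection E' D σ q u + mvfderiv (prodModels E' E) f q u • σ q := by
  have hf1 : MDifferentiableAt 𝓘(ℝ, E') 𝓘(ℝ, ℝ) (fun s => f (s, q.2)) q.1 :=
    hf.comp (I' := prodModels E' E) (f := fun s : B => (s, q.2)) q.1
      (mdifferentiableAt_slice_left q)
  have hf2 : MDifferentiableAt 𝓘(ℝ, E) 𝓘(ℝ, ℝ) (fun p => f (q.1, p)) q.2 :=
    hf.comp (I' := prodModels E' E) (f := fun p : N => (q.1, p)) q.2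
      (mdifferentiableAt_slice_right q)
  have h1 : D (fun p => f (q.1, p) • σ (q.1, p)) q.2 = _ :=
    D.isCovariantDerivativeOnUniv.leibniz hσ.slice hf2
  have h2 := mvfderiv_fun_smul hf1 hσ.curve
  simp only [pullbackConnection_apply, map_smul, h1, h2, mvfderiv_prod_split hf,
    add_apply, smul_apply, map_add,
    ContinuousLinearMap.smulRight_apply, ContinuousLinearEquiv.symm_apply_apply, add_smul, smul_add]
  abel

theorem pullbackConnection_endo {J : EndField 𝓘(ℝ, E) N}
    (hJ : ∀ (Y : VecField 𝓘(ℝ, E) N) (x : N), MDiffAt (T% Y) x →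
      ∀ u : TangentSpace 𝓘(ℝ, E) x, nablaEnd D J Y x u = 0)
    (hσ : SndDiffAt E' σ q) (u : TangentSpace (prodModels E' E) q) :
    pullbackConnection E' D (fun r => J r.2 (σ r)) q u =
      J q.2 (pullbackConnection E' D σ q u) := by
  have h1 := sub_eq_zero.1 (hJ (fun p => σ (q.1, p)) q.2 hσ.slice (tangentSnd q u))
  let A : E →L[ℝ] E := J q.2
  have h2 : mvfderiv 𝓘(ℝ, E') (fun s : B => tangentModel 𝓘(ℝ, E) q.2 (J q.2 (σ (s, q.2)))) q.1 =
      A.comp (mvfderiv 𝓘(ℝ, E') (fun s : B => tangentModel 𝓘(ℝ, E) q.2 (σ (s, q.2))) q.1) := by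
    refine (mfderiv_comp (I' := 𝓘(ℝ, E)) q.1 (g := A) (A.mdifferentiableAt) hσ.curve).trans ?_
    rw [A.mfderiv_eq]
    rfl
  rw [pullbackConnection_apply, h1, pullbackConnection_apply, map_add]
  dsimp only
  rw [h2]
  rfl

theorem pullbackConnection_metric {h : BilinField 𝓘(ℝ, E) N} (hh : SmoothBilin h)
    (hD : ∀ (Y Z : VecField 𝓘(ℝ, E) N) (x : N), MDiffAt (T% Y) x → MDiffAt (T% Z) x →
      ∀ u : TangentSpace 𝓘(ℝ, E) x, mvfderiv 𝓘(ℝ, E) (fun y => h y (Y y) (Z y)) x u =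
        h x (D Y x u) (Z x) + h x (Y x) (D Z x u))
    (hσ : SndDiffAt E' σ q) (hρ : SndDiffAt E' ρ q) (u : TangentSpace (prodModels E' E) q) :
    mvfderiv (prodModels E' E) (fun r => h r.2 (σ r) (ρ r)) q u =
      h q.2 (pullbackConnection E' D σ q u) (ρ q) +
        h q.2 (σ q) (pullbackConnection E' D ρ q u) := by
  rw [mvfderiv_prod_split (hσ.bilin hh hρ)]
  have h1 := hD (fun p => σ (q.1, p)) (fun p => ρ (q.1, p)) q.2 hσ.slice hρ.slice (tangentSnd q u)
  rw [h1]
  let b : E →L[ℝ] E →L[ℝ] ℝ := h q.2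
  have h2 : mvfderiv 𝓘(ℝ, E') (fun s : B => h q.2 (σ (s, q.2)) (ρ (s, q.2))) q.1 (tangentFst q u) =
      b (mvfderiv 𝓘(ℝ, E') (fun s : B => tangentModel 𝓘(ℝ, E) q.2 (σ (s, q.2))) q.1
          (tangentFst q u)) (tangentModel 𝓘(ℝ, E) q.2 (ρ q)) +
        b (tangentModel 𝓘(ℝ, E) q.2 (σ q))
          (mvfderiv 𝓘(ℝ, E') (fun s : B => tangentModel 𝓘(ℝ, E) q.2 (ρ (s, q.2))) q.1
            (tangentFst q u)) := by
    have hb := (b.isBoundedBilinearMap.hasFDerivAt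
      (tangentModel 𝓘(ℝ, E) q.2 (σ q), tangentModel 𝓘(ℝ, E) q.2 (ρ q)))
    have hp : HasMFDerivAt 𝓘(ℝ, E') 𝓘(ℝ, E × E) (fun s : B =>
        (tangentModel 𝓘(ℝ, E) q.2 (σ (s, q.2)), tangentModel 𝓘(ℝ, E) q.2 (ρ (s, q.2)))) q.1 _ :=
      ⟨hσ.curve.hasMFDerivAt.1.prodMk hρ.curve.hasMFDerivAt.1,
        hσ.curve.hasMFDerivAt.2.prodMk hρ.curve.hasMFDerivAt.2⟩
    have hc := (hb.hasMFDerivAt.comp (I' := 𝓘(ℝ, E × E)) q.1 hp).mfderiv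
    refine (congr($hc (tangentFst q u))).trans ?_
    exact add_comm _ _
  rw [h2]
  simp only [pullbackConnection_apply, map_add, add_apply]
  change _ + _ + (_ + _) = (b _ _ + _) + (b _ _ + _)
  rw [add_add_add_comm]
  rfl

theorem tangentSnd_mlieBracket [FiniteDimensional ℝ E] [FiniteDimensional ℝ E']
    [IsManifold 𝓘(ℝ, E') ∞ B]
    (hD : ∀ (X Y : VecField 𝓘(ℝ, E) N) (x : N), MDiffAt (T% X) x → MDiffAt (T% Y) x →
      D Y x (X x) - D X x (Y x) = VectorField.mlieBracket 𝓘(ℝ, E) X Y x)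
    {X Y : VecField (prodModels E' E) (B × N)} (hX : MDiffAt (T% X) q) (hY : MDiffAt (T% Y) q) :
    tangentSnd q (VectorField.mlieBracket (prodModels E' E) X Y q) =
      pullbackConnection E' D (fun r => tangentSnd r (Y r)) q (X q) -
        pullbackConnection E' D (fun r => tangentSnd r (X r)) q (Y q) := by
  have : IsManifold 𝓘(ℝ, E) 2 N := inferInstance
  have : IsManifold 𝓘(ℝ, E) 1 N := inferInstance
  have : IsManifold (prodModels E' E) 2 (B × N) := inferInstance
  have he : ContMDiffAt 𝓘(ℝ, E) 𝓘(ℝ, E) 2 (extChartAt 𝓘(ℝ, E) q.2) q.2 := contMDiffAt_extChartAt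
  have hf : ContMDiffAt (prodModels E' E) 𝓘(ℝ, E) 2
      (fun r : B × N => extChartAt 𝓘(ℝ, E) q.2 r.2) q := he.comp q contMDiffAt_snd
  have hev : ∀ᶠ p in nhds q.2, MDifferentiableAt 𝓘(ℝ, E) 𝓘(ℝ, E) (extChartAt 𝓘(ℝ, E) q.2) p :=
    ((contMDiffAt_iff_contMDiffAt_nhds (by simp)).1 he).mono fun z hz =>
      hz.mdifferentiableAt (by simp)
  have key : ∀ {Z : VecField (prodModels E' E) (B × N)}, MDiffAt (T% Z) q →
      ∀ u : TangentSpace (prodModels E' E) q,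
      mvfderiv (prodModels E' E) (fun r => mvfderiv (prodModels E' E)
        (fun r : B × N => extChartAt 𝓘(ℝ, E) q.2 r.2) r (Z r)) q u =
      mvfderiv 𝓘(ℝ, E') (fun s : B => tangentModel 𝓘(ℝ, E) q.2 (tangentSnd (s, q.2) (Z (s, q.2))))
        q.1 (tangentFst q u) +
      mvfderiv 𝓘(ℝ, E) (fun p : N => mvfderiv 𝓘(ℝ, E) (extChartAt 𝓘(ℝ, E) q.2) p
        (tangentSnd (q.1, p) (Z (q.1, p)))) q.2 (tangentSnd q u) := by
    intro Z hZ u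
    rw [mvfderiv_prod_split (mdifferentiableAt_mvfderiv_apply hf hZ)]
    congr 1
    · congr 2
      ext s
      rw [mvfderiv_comp_snd (q := (s, q.2)) (he.mdifferentiableAt (by simp)),
        mvfderiv_extChartAt_self]
      rfl
    · refine congr($(Filter.EventuallyEq.mfderiv_eq ?_) _)
      filter_upwards [hev] with p hp
      exact mvfderiv_comp_snd (q := (q.1, p)) hp _
  have h1 := mvfderiv_mlieBracket hf hX hY
  rw [key hX, key hY, mvfderiv_comp_snd (he.mdifferentiableAt (by simp)),
    mvfderiv_extChartAt_self] at h1
  have h2 := mvfderiv_mlieBracket he (sndDiffAt_tangentSnd hX).slice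
    (sndDiffAt_tangentSnd hY).slice
  rw [mvfderiv_extChartAt_self, ← hD _ _ _ (sndDiffAt_tangentSnd hX).slice
    (sndDiffAt_tangentSnd hY).slice] at h2
  apply (tangentModel 𝓘(ℝ, E) q.2).injective
  rw [ContinuousLinearEquiv.coe_coe] at h1 h2
  rw [h1]
  simp only [pullbackConnection_apply, map_sub, map_add,
    ContinuousLinearEquiv.apply_symm_apply] at h2 ⊢
  have h3 : ∀ a b c d e f : E, e - f = c - d → a + c - (b + d) = a + e - (b + f) := by
    intro a b c d e f h
    rw [add_sub_add_comm, add_sub_add_comm, h]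
  exact h3 _ _ _ _ _ _ h2

end PullbackConnection

section Coordinates

variable {E : Type*} [NormedAddCommGroup E] [NormedSpace ℝ E]
  {H : Type*} [TopologicalSpace H] {I : ModelWithCorners ℝ E H}
  {M : Type*} [TopologicalSpace M] [ChartedSpace H M] [IsManifold I ∞ M]

/-- The frame of the tangent bundle at `x` given by the chart at `x₀`. -/
def chartFrame (I : ModelWithCorners ℝ E H) [IsManifold I ∞ M] (x₀ x : M) :
    E →L[ℝ] TangentSpace I x :=
  (trivializationAt E (TangentSpace I) x₀).symmL ℝ x

/-- The coframe of the tangent bundle at `x` given by the chart at `x₀`. -/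
def chartCoframe (I : ModelWithCorners ℝ E H) [IsManifold I ∞ M] (x₀ x : M) :
    TangentSpace I x →L[ℝ] E :=
  (trivializationAt E (TangentSpace I) x₀).continuousLinearMapAt ℝ x

theorem eventually_mem_baseSet (x₀ : M) :
    ∀ᶠ x in nhds x₀, x ∈ (trivializationAt E (TangentSpace I : M → Type _) x₀).baseSet :=
  (trivializationAt E (TangentSpace I) x₀).open_baseSet.mem_nhds
    (mem_baseSet_trivializationAt E (TangentSpace I) x₀)

theorem chartFrame_coframe {x₀ x : M}
    (hx : x ∈ (trivializationAt E (TangentSpace I : M → Type _) x₀).baseSet)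
    (v : TangentSpace I x) : chartFrame I x₀ x (chartCoframe I x₀ x v) = v :=
  Bundle.Trivialization.symmL_continuousLinearMapAt _ hx v

/-- The pull-back of a bilinear form by a linear map. -/
def pullBilin {E E' : Type*} [NormedAddCommGroup E] [NormedSpace ℝ E]
    [NormedAddCommGroup E'] [NormedSpace ℝ E'] (b : E →L[ℝ] E →L[ℝ] ℝ) (A : E' →L[ℝ] E) :
    E' →L[ℝ] E' →L[ℝ] ℝ :=
  b.bilinearComp A A

/-- A field of bilinear forms written in the chart at `x₀`. -/
def bilinInChart (g : BilinField I M) (x₀ x : M) : E →L[ℝ] E →L[ℝ] ℝ :=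
  pullBilin (E := E) (g x) (chartFrame I x₀ x)

theorem bilinInChart_apply (g : BilinField I M) (x₀ x : M) (v w : E) :
    bilinInChart g x₀ x v w = g x (chartFrame I x₀ x v) (chartFrame I x₀ x w) := rfl

theorem smoothForm_iff {η : FormField I M} :
    SmoothForm η ↔ ∀ x₀ : M, ContMDiffAt I 𝓘(ℝ, E →L[ℝ] ℝ) ∞
      (fun x => (η x).comp (chartFrame I x₀ x)) x₀ := by
  refine forall_congr' fun x₀ => ?_
  rw [contMDiffAt_hom_bundle]
  refine (and_iff_right contMDiffAt_id).trans (Filter.EventuallyEq.contMDiffAt_iff ?_)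
  refine Filter.Eventually.of_forall fun x => ?_
  ext v
  change (trivializationAt ℝ (Bundle.Trivial M ℝ) x₀).continuousLinearMapAt ℝ x
    (η x (chartFrame I x₀ x v)) = _
  simp

theorem smoothBilin_iff {g : BilinField I M} :
    SmoothBilin g ↔ ∀ x₀ : M, ContMDiffAt I 𝓘(ℝ, E →L[ℝ] E →L[ℝ] ℝ) ∞ (bilinInChart g x₀) x₀ := by
  refine forall_congr' fun x₀ => ?_
  rw [contMDiffAt_hom_bundle]
  refine (and_iff_right contMDiffAt_id).trans (Filter.EventuallyEq.contMDiffAt_iff ?_)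
  filter_upwards [eventually_mem_baseSet (I := I) x₀] with x hx
  ext v w
  refine (inCoordinates_apply_eq₂ (E₃ := Bundle.Trivial M ℝ) hx hx (Set.mem_univ _)).trans ?_
  simp only [Trivial.fiberBundle_trivializationAt', Trivial.linearMapAt_trivialization,
    LinearMap.id_coe, id_eq, bilinInChart_apply, chartFrame]
  rw [Bundle.Trivialization.symmL_apply _ hx, Bundle.Trivialization.symmL_apply _ hx]

theorem smoothEnd_iff {φ : EndField I M} :
    SmoothEnd φ ↔ ∀ x₀ : M, ContMDiffAt I 𝓘(ℝ, E →L[ℝ] E) ∞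
      (fun x => (chartCoframe I x₀ x).comp ((φ x).comp (chartFrame I x₀ x))) x₀ := by
  refine forall_congr' fun x₀ => ?_
  rw [contMDiffAt_hom_bundle]
  exact and_iff_right contMDiffAt_id

variable {E' : Type*} [NormedAddCommGroup E'] [NormedSpace ℝ E']
  {H' : Type*} [TopologicalSpace H'] {I' : ModelWithCorners ℝ E' H'}
  {M' : Type*} [TopologicalSpace M'] [ChartedSpace H' M'] [IsManifold I' ∞ M']

/-- The differential of a smooth map, in coordinates, depends smoothly on the point. -/
theorem contMDiffAt_mfderiv_inChart {f : M → M'} (hf : ContMDiff I I' ∞ f) (x₀ : M) :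
    ContMDiffAt I 𝓘(ℝ, E →L[ℝ] E') ∞
      (fun x => (chartCoframe I' (f x₀) (f x)).comp
        ((mfderiv I I' f x).comp (chartFrame I x₀ x))) x₀ :=
  (hf x₀).mfderiv_const (m := ∞) (by simp)

theorem contDiff_flip {E₁ E₂ : Type*} [NormedAddCommGroup E₁] [NormedSpace ℝ E₁]
    [NormedAddCommGroup E₂] [NormedSpace ℝ E₂] :
    ContDiff ℝ ∞ (fun a : E₁ →L[ℝ] E₂ →L[ℝ] ℝ => a.flip) := by
  have h : IsBoundedLinearMap ℝ (fun a : E₁ →L[ℝ] E₂ →L[ℝ] ℝ => a.flip) :=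
    ⟨⟨fun _ _ => rfl, fun _ _ => rfl⟩, 1, one_pos, fun a => by simp⟩
  exact IsBoundedLinearMap.contDiff (E := E₁ →L[ℝ] E₂ →L[ℝ] ℝ) (F := E₂ →L[ℝ] E₁ →L[ℝ] ℝ) h

theorem contDiff_pullBilin {E₁ E₂ : Type*} [NormedAddCommGroup E₁] [NormedSpace ℝ E₁]
    [NormedAddCommGroup E₂] [NormedSpace ℝ E₂] :
    ContDiff ℝ ∞ (fun p : (E₁ →L[ℝ] E₁ →L[ℝ] ℝ) × (E₂ →L[ℝ] E₁) => pullBilin p.1 p.2) := by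
  have h0 : ContDiff ℝ ∞ (fun p : (E₁ →L[ℝ] E₁ →L[ℝ] ℝ) × (E₂ →L[ℝ] E₁) => p.1.comp p.2) :=
    contDiff_fst.clm_comp contDiff_snd
  have h1 : ContDiff ℝ ∞ (fun p : (E₁ →L[ℝ] E₁ →L[ℝ] ℝ) × (E₂ →L[ℝ] E₁) =>
      (p.1.comp p.2).flip) := contDiff_flip.comp h0
  have h2 : ContDiff ℝ ∞ (fun p : (E₁ →L[ℝ] E₁ →L[ℝ] ℝ) × (E₂ →L[ℝ] E₁) =>
      (p.1.comp p.2).flip.comp p.2) := h1.clm_comp contDiff_snd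
  exact contDiff_flip.comp h2

omit [IsManifold I ∞ M] in
theorem contMDiffAt_pullBilin {E₁ E₂ : Type*} [NormedAddCommGroup E₁] [NormedSpace ℝ E₁]
    [NormedAddCommGroup E₂] [NormedSpace ℝ E₂] {b : M → E₁ →L[ℝ] E₁ →L[ℝ] ℝ}
    {A : M → E₂ →L[ℝ] E₁} {x₀ : M} (hb : ContMDiffAt I 𝓘(ℝ, E₁ →L[ℝ] E₁ →L[ℝ] ℝ) ∞ b x₀)
    (hA : ContMDiffAt I 𝓘(ℝ, E₂ →L[ℝ] E₁) ∞ A x₀) :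
    ContMDiffAt I 𝓘(ℝ, E₂ →L[ℝ] E₂ →L[ℝ] ℝ) ∞ (fun x => pullBilin (b x) (A x)) x₀ := by
  have h : ContDiffAt ℝ ∞ (fun p : (E₁ →L[ℝ] E₁ →L[ℝ] ℝ) × (E₂ →L[ℝ] E₁) => pullBilin p.1 p.2)
      (b x₀, A x₀) := contDiff_pullBilin.contDiffAt
  exact ContDiffAt.comp_contMDiffAt (f := fun x => (b x, A x)) h (hb.prodMk_space hA)

theorem SmoothForm.pullback {f : M → M'} (hf : ContMDiff I I' ∞ f) {θ : FormField I' M'}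
    (hθ : SmoothForm θ) : SmoothForm (fun x => (θ (f x)).comp (mfderiv I I' f x)) := by
  rw [smoothForm_iff] at hθ ⊢
  intro x₀
  have h1 := ((hθ (f x₀)).comp x₀ (hf x₀)).clm_comp (contMDiffAt_mfderiv_inChart hf x₀)
  refine h1.congr_of_eventuallyEq ?_
  filter_upwards [hf.continuous.continuousAt.eventually (eventually_mem_baseSet (I := I') (f x₀))]
    with x hx
  ext v
  simp only [ContinuousLinearMap.comp_apply, Function.comp_apply]
  rw [chartFrame_coframe hx]

/-- The pull-back of a field of bilinear forms by a map. -/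
def bilinPullback (I : ModelWithCorners ℝ E H) (f : M → M') (h : BilinField I' M') :
    BilinField I M := fun x =>
  pullBilin (E := E') (E' := E) (h (f x)) (mfderiv I I' f x)

theorem SmoothBilin.pullback {f : M → M'} (hf : ContMDiff I I' ∞ f) {h : BilinField I' M'}
    (hh : SmoothBilin h) :
    SmoothBilin (bilinPullback I f h) := by
  rw [smoothBilin_iff] at hh ⊢
  intro x₀
  have h1 := contMDiffAt_pullBilin (I := I) ((hh (f x₀)).comp x₀ (hf x₀)) (contMDiffAt_mfderiv_inChart hf x₀)
  refine h1.congr_of_eventuallyEq ?_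
  filter_upwards [hf.continuous.continuousAt.eventually (eventually_mem_baseSet (I := I') (f x₀))]
    with x hx
  ext v w
  change h (f x) (mfderiv I I' f x (chartFrame I x₀ x v)) (mfderiv I I' f x (chartFrame I x₀ x w)) =
    h (f x) (chartFrame I' (f x₀) (f x) (chartCoframe I' (f x₀) (f x)
      (mfderiv I I' f x (chartFrame I x₀ x v)))) (chartFrame I' (f x₀) (f x)
        (chartCoframe I' (f x₀) (f x) (mfderiv I I' f x (chartFrame I x₀ x w))))
  rw [chartFrame_coframe hx, chartFrame_coframe hx]

theorem SmoothBilin.add {g g' : BilinField I M} (hg : SmoothBilin g) (hg' : SmoothBilin g') :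
    SmoothBilin (fun x => g x + g' x) := by
  rw [smoothBilin_iff] at *
  intro x₀
  have h := ContMDiffAt.add (hg x₀) (hg' x₀)
  refine h.congr_of_eventuallyEq (Filter.Eventually.of_forall fun x => ?_)
  ext v w
  rfl

theorem SmoothBilin.smul {g : BilinField I M} (hg : SmoothBilin g) {f : M → ℝ}
    (hf : ContMDiff I 𝓘(ℝ, ℝ) ∞ f) : SmoothBilin (fun x => f x • g x) := by
  rw [smoothBilin_iff] at *
  intro x₀
  have h := ContMDiffAt.smul (hf x₀) (hg x₀)
  refine h.congr_of_eventuallyEq (Filter.Eventually.of_forall fun x => ?_)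
  ext v w
  rfl

theorem SmoothForm.sq {η : FormField I M} (hη : SmoothForm η) :
    SmoothBilin (fun x => (η x).smulRight (η x)) := by
  rw [smoothForm_iff] at hη
  rw [smoothBilin_iff]
  intro x₀
  have h1 : ContDiff ℝ ∞ (fun f : E →L[ℝ] ℝ => f.smulRight f) := contDiff_id.smulRight contDiff_id
  exact h1.comp_contMDiffAt (hη x₀)

theorem SmoothBilin.comp_left {g : BilinField I M} (hg : SmoothBilin g) {J : EndField I M}
    (hJ : SmoothEnd J) : SmoothBilin (fun x => (g x).comp (J x)) := by
  rw [smoothBilin_iff] at hg ⊢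
  rw [smoothEnd_iff] at hJ
  intro x₀
  refine ((hg x₀).clm_comp (hJ x₀)).congr_of_eventuallyEq ?_
  filter_upwards [eventually_mem_baseSet (I := I) x₀] with x hx
  ext v w
  change g x (J x (chartFrame I x₀ x v)) (chartFrame I x₀ x w) =
    g x (chartFrame I x₀ x (chartCoframe I x₀ x (J x (chartFrame I x₀ x v)))) (chartFrame I x₀ x w)
  rw [chartFrame_coframe hx]

/-- The form `½ Im(w̄ dw)` attached to a complex-valued function `w`. -/
def argForm (I : ModelWithCorners ℝ E H) (w : M → ℂ) : FormField I M := fun x =>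
  (((1 / 2 : ℝ) • Complex.imCLM).comp (ContinuousLinearMap.mul ℝ ℂ (starRingEnd ℂ (w x)))).comp
    (mvfderiv I w x)

omit [IsManifold I ∞ M] in
theorem argForm_apply (w : M → ℂ) (x : M) (v : TangentSpace I x) :
    argForm I w x v = 1 / 2 * (starRingEnd ℂ (w x) * mvfderiv I w x v).im := rfl

theorem smoothForm_argForm {w : M → ℂ} (hw : ContMDiff I 𝓘(ℝ, ℂ) ∞ w) :
    SmoothForm (argForm I w) := by
  rw [smoothForm_iff]
  intro x₀
  have h1 := contMDiffAt_mfderiv_inChart hw x₀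
  have h2 : ContMDiffAt I 𝓘(ℝ, ℂ →L[ℝ] ℂ) ∞
      (fun x => ContinuousLinearMap.mul ℝ ℂ (starRingEnd ℂ (w x))) x₀ :=
    contMDiffAt_const.clm_apply
      ((Complex.conjCLE : ℂ →L[ℝ] ℂ).contMDiff.contMDiffAt.comp x₀ (hw x₀))
  have h3 : ContMDiffAt I 𝓘(ℝ, ℂ →L[ℝ] ℝ) ∞ (fun x => ((1 / 2 : ℝ) • Complex.imCLM).comp
      (ContinuousLinearMap.mul ℝ ℂ (starRingEnd ℂ (w x)))) x₀ :=
    contMDiffAt_const.clm_comp h2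
  refine (h3.clm_comp h1).congr_of_eventuallyEq (Filter.Eventually.of_forall fun x => ?_)
  ext v
  have h4 : ∀ z : ℂ, chartCoframe 𝓘(ℝ, ℂ) (w x₀) (w x) z = z := by
    intro z
    have := TangentBundle.continuousLinearMapAt_model_space (𝕜 := ℝ) (w x₀) (w x)
    exact congr($this z)
  change 1 / 2 * (starRingEnd ℂ (w x) * mvfderiv I w x (chartFrame I x₀ x v)).im =
    1 / 2 * (starRingEnd ℂ (w x) *
      chartCoframe 𝓘(ℝ, ℂ) (w x₀) (w x) (mvfderiv I w x (chartFrame I x₀ x v))).im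
  rw [h4]

end Coordinates

section AngularFrame

variable {E' : Type*} [NormedAddCommGroup E'] [NormedSpace ℝ E']
  {B : Type*} [TopologicalSpace B] [ChartedSpace E' B] [IsManifold 𝓘(ℝ, E') ∞ B]

/-- A smooth function `w` to the unit circle of `ℂ` and a smooth vector field `τ` which spans the
tangent spaces of `B` and along which the argument of `w` grows at rate `2`. -/
structure IsAngularFrame (w : B → ℂ) (τ : VecField 𝓘(ℝ, E') B) : Prop where
  smooth_w : ContMDiff 𝓘(ℝ, E') 𝓘(ℝ, ℂ) ∞ w
  conj_mul : ∀ t, starRingEnd ℂ (w t) * w t = 1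
  smooth_τ : SmoothVec τ
  deriv_τ : ∀ t, mvfderiv 𝓘(ℝ, E') w t (τ t) = 2 * Complex.I * w t
  span : ∀ (t : B) (v : TangentSpace 𝓘(ℝ, E') t), ∃ a : ℝ, v = a • τ t

variable {w : B → ℂ} {τ : VecField 𝓘(ℝ, E') B}

namespace IsAngularFrame

theorem argForm_τ (hw : IsAngularFrame w τ) (t : B) : argForm 𝓘(ℝ, E') w t (τ t) = 1 := by
  rw [argForm_apply, hw.deriv_τ, show starRingEnd ℂ (w t) * (2 * Complex.I * w t) =
    2 * Complex.I * (starRingEnd ℂ (w t) * w t) by ring, hw.conj_mul]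
  simp

theorem argForm_smul_τ (hw : IsAngularFrame w τ) (t : B) (v : TangentSpace 𝓘(ℝ, E') t) :
    argForm 𝓘(ℝ, E') w t v • τ t = v := by
  obtain ⟨a, rfl⟩ := hw.span t v
  rw [map_smul, hw.argForm_τ, smul_eq_mul, mul_one]

theorem mvfderiv_w (hw : IsAngularFrame w τ) (t : B) (v : TangentSpace 𝓘(ℝ, E') t) :
    mvfderiv 𝓘(ℝ, E') w t v = argForm 𝓘(ℝ, E') w t v • (2 * Complex.I * w t) := by
  conv_lhs => rw [← hw.argForm_smul_τ t v, map_smul, hw.deriv_τ]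

theorem ext_argForm (hw : IsAngularFrame w τ) {t : B} {u v : TangentSpace 𝓘(ℝ, E') t}
    (h : argForm 𝓘(ℝ, E') w t u = argForm 𝓘(ℝ, E') w t v) : u = v := by
  rw [← hw.argForm_smul_τ t u, h, hw.argForm_smul_τ]

theorem mvfderiv_re (hw : IsAngularFrame w τ) (t : B) (v : TangentSpace 𝓘(ℝ, E') t) :
    mvfderiv 𝓘(ℝ, E') (fun s => (w s).re) t v = -2 * (w t).im * argForm 𝓘(ℝ, E') w t v := by
  have h1 : mvfderiv 𝓘(ℝ, E') (fun s => (w s).re) t v = (mvfderiv 𝓘(ℝ, E') w t v).re := by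
    have h2 : MDifferentiableAt 𝓘(ℝ, ℂ) 𝓘(ℝ, ℝ) Complex.re (w t) :=
      Complex.reCLM.differentiableAt.mdifferentiableAt
    have h3 := mfderiv_comp_apply (I' := 𝓘(ℝ, ℂ)) t (g := Complex.re) h2
      (hw.smooth_w.mdifferentiableAt (by simp)) v
    refine h3.trans ?_
    rw [mfderiv_eq_fderiv]
    exact congr($(Complex.reCLM.fderiv) _)
  rw [h1, hw.mvfderiv_w]
  simp
  ring

theorem mvfderiv_im (hw : IsAngularFrame w τ) (t : B) (v : TangentSpace 𝓘(ℝ, E') t) :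
    mvfderiv 𝓘(ℝ, E') (fun s => (w s).im) t v = 2 * (w t).re * argForm 𝓘(ℝ, E') w t v := by
  have h1 : mvfderiv 𝓘(ℝ, E') (fun s => (w s).im) t v = (mvfderiv 𝓘(ℝ, E') w t v).im := by
    have h2 : MDifferentiableAt 𝓘(ℝ, ℂ) 𝓘(ℝ, ℝ) Complex.im (w t) :=
      Complex.imCLM.differentiableAt.mdifferentiableAt
    have h3 := mfderiv_comp_apply (I' := 𝓘(ℝ, ℂ)) t (g := Complex.im) h2
      (hw.smooth_w.mdifferentiableAt (by simp)) v
    refine h3.trans ?_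
    rw [mfderiv_eq_fderiv]
    exact congr($(Complex.imCLM.fderiv) _)
  rw [h1, hw.mvfderiv_w]
  simp
  ring

end IsAngularFrame

end AngularFrame

section Tensors

variable {E' : Type*} [NormedAddCommGroup E'] [NormedSpace ℝ E']
  {B : Type*} [TopologicalSpace B] [ChartedSpace E' B]
  {E : Type*} [NormedAddCommGroup E] [NormedSpace ℝ E]
  {N : Type*} [TopologicalSpace N] [ChartedSpace E N]

/-- The structure on `B × N` with `φ = J` on the tangent spaces of `N`, `ξ = τ`, `η = ½ d(arg w)`
and `g = η ⊗ η + Re w · h - Im w · h̃`. -/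
def twistedTensors (w : B → ℂ) (τ : VecField 𝓘(ℝ, E') B) (J : EndField 𝓘(ℝ, E) N)
    (h : BilinField 𝓘(ℝ, E) N) : ContactTensors (prodModels E' E) (B × N) where
  φ q := (tangentInr q).comp ((J q.2).comp (tangentSnd q))
  ξ q := tangentInl q (τ q.1)
  η q := (argForm 𝓘(ℝ, E') w q.1).comp (tangentFst q)
  g q := ((argForm 𝓘(ℝ, E') w q.1).comp (tangentFst q)).smulRight
      ((argForm 𝓘(ℝ, E') w q.1).comp (tangentFst q)) +
    (w q.1).re • bilinPullback (prodModels E' E) Prod.snd h q -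
    (w q.1).im • bilinPullback (prodModels E' E) Prod.snd (associated J h) q

variable {w : B → ℂ} {τ : VecField 𝓘(ℝ, E') B} {J : EndField 𝓘(ℝ, E) N}
  {h : BilinField 𝓘(ℝ, E) N}

theorem twistedTensors_φ (q : B × N) (u : TangentSpace (prodModels E' E) q) :
    (twistedTensors w τ J h).φ q u = tangentInr q (J q.2 (tangentSnd q u)) := rfl

theorem twistedTensors_ξ (q : B × N) :
    (twistedTensors w τ J h).ξ q = tangentInl q (τ q.1) := rfl

theorem twistedTensors_η (q : B × N) (u : TangentSpace (prodModels E' E) q) :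
    (twistedTensors w τ J h).η q u = argForm 𝓘(ℝ, E') w q.1 (tangentFst q u) := rfl

theorem twistedTensors_g (q : B × N) (u v : TangentSpace (prodModels E' E) q) :
    (twistedTensors w τ J h).g q u v =
      argForm 𝓘(ℝ, E') w q.1 (tangentFst q u) * argForm 𝓘(ℝ, E') w q.1 (tangentFst q v) +
        (w q.1).re * h q.2 (tangentSnd q u) (tangentSnd q v) -
        (w q.1).im * h q.2 (J q.2 (tangentSnd q u)) (tangentSnd q v) := rfl

@[simp]
theorem twistedTensors_η_inr (q : B × N) (a : TangentSpace 𝓘(ℝ, E) q.2) :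
    (twistedTensors w τ J h).η q (tangentInr q a) = 0 := by
  rw [twistedTensors_η, tangentFst_inr, map_zero]

@[simp]
theorem tangentSnd_ξ (q : B × N) : tangentSnd q ((twistedTensors w τ J h).ξ q) = 0 :=
  tangentSnd_inl q _

@[simp]
theorem tangentSnd_φ (q : B × N) (u : TangentSpace (prodModels E' E) q) :
    tangentSnd q ((twistedTensors w τ J h).φ q u) = J q.2 (tangentSnd q u) :=
  tangentSnd_inr q _

@[simp]
theorem twistedTensors_η_φ (q : B × N) (u : TangentSpace (prodModels E' E) q) :
    (twistedTensors w τ J h).η q ((twistedTensors w τ J h).φ q u) = 0 := by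
  rw [twistedTensors_φ, twistedTensors_η_inr]

/-- The rotation `α + β J` of the tangent spaces of `N`, where `α + iβ = z`. -/
def rotation (J : EndField 𝓘(ℝ, E) N) (z : ℂ) (p : N) :
    TangentSpace 𝓘(ℝ, E) p →L[ℝ] TangentSpace 𝓘(ℝ, E) p :=
  z.re • ContinuousLinearMap.id ℝ _ + z.im • J p

theorem rotation_apply (z : ℂ) (p : N) (u : TangentSpace 𝓘(ℝ, E) p) :
    rotation J z p u = z.re • u + z.im • J p u := rfl

theorem rotation_rotation (hJ : ∀ p u, J p (J p u) = -u) (y z : ℂ) (p : N)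
    (u : TangentSpace 𝓘(ℝ, E) p) : rotation J y p (rotation J z p u) = rotation J (y * z) p u := by
  simp only [rotation_apply, map_add, map_smul, hJ, Complex.mul_re, Complex.mul_im]
  module

theorem J_left_eq_right (hJ : ∀ p u, J p (J p u) = -u)
    (hh : ∀ p u v, h p (J p u) (J p v) = -h p u v) (p : N) (u v : TangentSpace 𝓘(ℝ, E) p) :
    h p (J p u) v = h p u (J p v) := by
  have := hh p u (J p v)
  rw [hJ, map_neg] at this
  exact neg_injective this

theorem twisted_rotation (hJ : ∀ p u, J p (J p u) = -u)
    (hh : ∀ p u v, h p (J p u) (J p v) = -h p u v) {y z : ℂ}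
    (hz : z ^ 2 = y) (hy : starRingEnd ℂ y * y = 1) (p : N) (u v : TangentSpace 𝓘(ℝ, E) p) :
    y.re * h p (rotation J z p u) (rotation J z p v) -
      y.im * h p (J p (rotation J z p u)) (rotation J z p v) = h p u v := by
  have h1 : y.re = z.re * z.re - z.im * z.im := by rw [← hz, sq, Complex.mul_re]
  have h2 : y.im = 2 * z.re * z.im := by rw [← hz, sq, Complex.mul_im]; ring
  have h3 : y.re * y.re + y.im * y.im = 1 := by
    have := congrArg Complex.re hy
    simpa [Complex.mul_re] using this
  have h4 : h p u (J p v) = h p (J p u) v := (J_left_eq_right hJ hh p u v).symm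
  simp only [rotation_apply, map_add, map_smul, add_apply, smul_apply, smul_eq_mul, hJ, map_neg,
    neg_apply, hh, h4]
  rw [h1, h2] at *
  linear_combination h p u v * h3

variable [IsManifold 𝓘(ℝ, E') ∞ B]

@[simp]
theorem IsAngularFrame.twistedTensors_η_ξ (hw : IsAngularFrame w τ) (q : B × N) :
    (twistedTensors w τ J h).η q ((twistedTensors w τ J h).ξ q) = 1 := by
  rw [twistedTensors_ξ, twistedTensors_η, tangentFst_inl, hw.argForm_τ]

theorem IsAngularFrame.smul_ξ_add_inr (hw : IsAngularFrame w τ) (q : B × N)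
    (u : TangentSpace (prodModels E' E) q) :
    (twistedTensors w τ J h).η q u • (twistedTensors w τ J h).ξ q + tangentInr q (tangentSnd q u) =
      u := by
  rw [twistedTensors_η, twistedTensors_ξ, ← map_smul, hw.argForm_smul_τ, tangentInl_fst_add_inr_snd]

theorem IsAngularFrame.tangent_ext (hw : IsAngularFrame w τ) {q : B × N}
    {u v : TangentSpace (prodModels E' E) q}
    (h₁ : (twistedTensors w τ J h).η q u = (twistedTensors w τ J h).η q v)
    (h₂ : tangentSnd q u = tangentSnd q v) : u = v :=
  tangent_prod_ext (hw.ext_argForm h₁) h₂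

variable [IsManifold 𝓘(ℝ, E) ∞ N]

theorem SmoothVec.tangentInl (hτ : SmoothVec τ) :
    SmoothVec (fun q : B × N => tangentInl (E := E) q (τ q.1)) := by
  have h1 : ContMDiff (prodModels E' E) (𝓘(ℝ, E').tangent.prod 𝓘(ℝ, E).tangent) ∞
      (fun q : B × N => ((⟨q.1, τ q.1⟩ : TangentBundle 𝓘(ℝ, E') B),
        (⟨q.2, 0⟩ : TangentBundle 𝓘(ℝ, E) N))) :=
    (hτ.comp contMDiff_fst).prodMk
      ((Bundle.contMDiff_zeroSection ℝ (TangentSpace 𝓘(ℝ, E) : N → Type _)).comp contMDiff_snd)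
  refine (contMDiff_equivTangentBundleProd_symm.comp h1).congr fun q => ?_
  change (⟨q, SasakiLike.tangentInl q (τ q.1)⟩ : TangentBundle (prodModels E' E) (B × N)) = ⟨q, (τ q.1, 0)⟩
  rw [tangentInl_eq]
  rfl

theorem smoothForm_η (hw : ContMDiff 𝓘(ℝ, E') 𝓘(ℝ, ℂ) ∞ w) :
    SmoothForm (twistedTensors w τ J h).η :=
  (smoothForm_argForm hw).pullback contMDiff_fst

theorem contMDiffAt_tangentInr_inChart (q₀ : B × N) :
    ContMDiffAt (prodModels E' E) 𝓘(ℝ, E →L[ℝ] E' × E) ∞ (fun q : B × N =>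
      (chartCoframe (prodModels E' E) q₀ q).comp
        ((tangentInr q).comp (chartFrame 𝓘(ℝ, E) q₀.2 q.2))) q₀ := by
  have h1 : ContMDiff ((prodModels E' E).prod 𝓘(ℝ, E)) (prodModels E' E) ∞
      (Function.uncurry fun (q : B × N) (p : N) => (q.1, p)) :=
    (contMDiff_fst.comp contMDiff_fst).prodMk contMDiff_snd
  exact ContMDiffAt.mfderiv (m := ∞) (n := ∞) (fun (q : B × N) (p : N) => (q.1, p)) Prod.snd
    (h1 (q₀, q₀.2)) (contMDiff_snd q₀) (by simp)

theorem smoothEnd_φ (hJ : SmoothEnd J) : SmoothEnd (twistedTensors w τ J h).φ := by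
  rw [smoothEnd_iff] at hJ ⊢
  intro q₀
  have h1 := contMDiffAt_mfderiv_inChart
    (contMDiff_snd (I := 𝓘(ℝ, E')) (J := 𝓘(ℝ, E)) (M := B) (N := N) (n := ∞)) q₀
  have h2 := (hJ q₀.2).comp q₀ (contMDiff_snd (I := 𝓘(ℝ, E')) (J := 𝓘(ℝ, E)) (n := ∞) q₀)
  refine ((contMDiffAt_tangentInr_inChart q₀).clm_comp (h2.clm_comp h1)).congr_of_eventuallyEq ?_
  filter_upwards [(continuous_snd.tendsto q₀).eventually (eventually_mem_baseSet (I := 𝓘(ℝ, E)) q₀.2)]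
    with q hq
  refine ContinuousLinearMap.ext fun v => ?_
  change chartCoframe (prodModels E' E) q₀ q (tangentInr q (J q.2 (tangentSnd q
      (chartFrame (prodModels E' E) q₀ q v)))) =
    chartCoframe (prodModels E' E) q₀ q (tangentInr q (chartFrame 𝓘(ℝ, E) q₀.2 q.2
      (chartCoframe 𝓘(ℝ, E) q₀.2 q.2 (J q.2 (chartFrame 𝓘(ℝ, E) q₀.2 q.2
        (chartCoframe 𝓘(ℝ, E) q₀.2 q.2 (tangentSnd q (chartFrame (prodModels E' E) q₀ q v))))))))
  rw [chartFrame_coframe hq, chartFrame_coframe hq]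

theorem smoothBilin_g (hw : ContMDiff 𝓘(ℝ, E') 𝓘(ℝ, ℂ) ∞ w) (hJ : SmoothEnd J)
    (hh : SmoothBilin h) : SmoothBilin (twistedTensors w τ J h).g := by
  have h1 : ContMDiff (prodModels E' E) 𝓘(ℝ, ℝ) ∞ (fun q : B × N => (w q.1).re) :=
    Complex.reCLM.contMDiff.comp (hw.comp contMDiff_fst)
  have h2 : ContMDiff (prodModels E' E) 𝓘(ℝ, ℝ) ∞ (fun q : B × N => -(w q.1).im) :=
    (-Complex.imCLM).contMDiff.comp (hw.comp contMDiff_fst)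
  have h3 := ((smoothForm_η (w := w) (τ := τ) (J := J) (h := h) hw).sq.add
    ((hh.pullback contMDiff_snd).smul h1)).add
      (((hh.comp_left hJ).pullback contMDiff_snd).smul h2)
  refine cast (congrArg SmoothBilin ?_) h3
  ext q u v
  rw [twistedTensors_g, sub_eq_add_neg, ← neg_mul]
  rfl

omit [IsManifold 𝓘(ℝ, E) ∞ N] in
theorem IsAngularFrame.twistedTensors_g_eq (hw : IsAngularFrame w τ)
    (hJ : ∀ p u, J p (J p u) = -u)
    (hh : ∀ p u v, h p (J p u) (J p v) = -h p u v) {q : B × N} {z : ℂ} (hz : z ^ 2 = w q.1)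
    (x y : ℝ) (u v : TangentSpace 𝓘(ℝ, E) q.2) :
    (twistedTensors w τ J h).g q
      (x • (twistedTensors w τ J h).ξ q + tangentInr q (rotation J z q.2 u))
      (y • (twistedTensors w τ J h).ξ q + tangentInr q (rotation J z q.2 v)) =
        x * y + h q.2 u v := by
  rw [← twisted_rotation hJ hh hz (hw.conj_mul q.1), twistedTensors_g]
  simp only [twistedTensors_ξ, map_add, map_smul, tangentFst_inl, tangentFst_inr, tangentSnd_inl,
    tangentSnd_inr, hw.argForm_τ, smul_zero, zero_add, add_zero, smul_eq_mul, mul_one]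
  ring

/-- The tangent spaces of `B × N`, decomposed by means of the vertical vector `ξ` and the rotation
of the tangent space of `N` by a complex number `z` of modulus one. -/
def IsAngularFrame.tangentEquiv (hw : IsAngularFrame w τ) (h : BilinField 𝓘(ℝ, E) N)
    (hJ : ∀ p u, J p (J p u) = -u) (q : B × N) (z : ℂ)
    (hz : z * starRingEnd ℂ z = 1) :
    (TangentSpace 𝓘(ℝ, E) q.2 × ℝ) ≃ₗ[ℝ] TangentSpace (prodModels E' E) q where
  toFun a := a.2 • (twistedTensors w τ J h).ξ q + tangentInr q (rotation J z q.2 a.1)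
  map_add' a b := by
    simp only [Prod.snd_add, Prod.fst_add, map_add, add_smul]
    abel
  map_smul' c a := by
    simp only [Prod.smul_snd, Prod.smul_fst, map_smul, smul_add, smul_smul, smul_eq_mul,
      RingHom.id_apply]
  invFun u := (rotation J (starRingEnd ℂ z) q.2 (tangentSnd q u), (twistedTensors w τ J h).η q u)
  left_inv a := by
    have h1 : ∀ v : TangentSpace 𝓘(ℝ, E) q.2, rotation J 1 q.2 v = v := by simp [rotation_apply]
    simp [rotation_rotation hJ, mul_comm _ z, hz, h1, hw.twistedTensors_η_ξ]
  right_inv u := by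
    have h1 : ∀ v : TangentSpace 𝓘(ℝ, E) q.2, rotation J 1 q.2 v = v := by simp [rotation_apply]
    simp [rotation_rotation hJ, hz, h1, hw.smul_ξ_add_inr]

omit [IsManifold 𝓘(ℝ, E) ∞ N] in
theorem IsAngularFrame.signature (hw : IsAngularFrame w τ) (hJ : ∀ p u, J p (J p u) = -u)
    (hh : ∀ p u v, h p (J p u) (J p v) = -h p u v) {m n : ℕ} (q : B × N)
    (e : Module.Basis (Fin m ⊕ Fin n) ℝ (TangentSpace 𝓘(ℝ, E) q.2))
    (he : ∀ i j, i ≠ j → h q.2 (e i) (e j) = 0) (hl : ∀ i, h q.2 (e (.inl i)) (e (.inl i)) = 1)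
    (hr : ∀ j, h q.2 (e (.inr j)) (e (.inr j)) = -1) :
    ∃ b : Module.Basis (Fin (m + 1) ⊕ Fin n) ℝ (TangentSpace (prodModels E' E) q),
      (∀ i j, i ≠ j → (twistedTensors w τ J h).g q (b i) (b j) = 0) ∧
      (∀ i, (twistedTensors w τ J h).g q (b (.inl i)) (b (.inl i)) = 1) ∧
      (∀ j, (twistedTensors w τ J h).g q (b (.inr j)) (b (.inr j)) = -1) := by
  obtain ⟨z, hz⟩ := IsAlgClosed.exists_pow_nat_eq (w q.1) zero_lt_two
  have hz1 : z * starRingEnd ℂ z = 1 := by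
    have h1 := hw.conj_mul q.1
    rw [← hz, map_pow, ← mul_pow, ← Complex.normSq_eq_conj_mul_self, ← Complex.ofReal_pow,
      Complex.ofReal_eq_one, pow_eq_one_iff_of_nonneg (Complex.normSq_nonneg z) two_ne_zero] at h1
    rw [Complex.mul_conj, h1, Complex.ofReal_one]
  let b₀ := (e.prod (Module.Basis.singleton (Fin 1) ℝ)).map (hw.tangentEquiv h hJ q z hz1)
  let σ : (Fin m ⊕ Fin n) ⊕ Fin 1 ≃ Fin (m + 1) ⊕ Fin n :=
    (Equiv.sumAssoc _ _ _).trans (((Equiv.refl _).sumCongr (Equiv.sumComm _ _)).trans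
      ((Equiv.sumAssoc _ _ _).symm.trans (finSumFinEquiv.sumCongr (Equiv.refl _))))
  have hg : ∀ a a', (twistedTensors w τ J h).g q (hw.tangentEquiv h hJ q z hz1 a)
      (hw.tangentEquiv h hJ q z hz1 a') = a.2 * a'.2 + h q.2 a.1 a'.1 := fun a a' =>
    hw.twistedTensors_g_eq hJ hh hz a.2 a'.2 a.1 a'.1
  have hb : ∀ i j, (twistedTensors w τ J h).g q (b₀ i) (b₀ j) =
      Sum.elim (fun i' => Sum.elim (fun j' => h q.2 (e i') (e j')) 0 j)
        (fun _ => Sum.elim 0 (fun _ => 1) j) i := by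
    rintro (i | i) (j | j) <;>
      simp [b₀, hg, Module.Basis.prod_apply]
  refine ⟨b₀.reindex σ, fun i j hij => ?_, fun i => ?_, fun j => ?_⟩
  · obtain ⟨i, rfl⟩ := σ.surjective i
    obtain ⟨j, rfl⟩ := σ.surjective j
    rw [Module.Basis.reindex_apply, Module.Basis.reindex_apply, Equiv.symm_apply_apply,
      Equiv.symm_apply_apply, hb]
    rcases i with i | i <;> rcases j with j | j
    · exact he _ _ fun h => hij (by rw [h])
    · rfl
    · rfl
    · exact absurd (by rw [Subsingleton.elim i j]) hij
  · obtain ⟨i, rfl⟩ := finSumFinEquiv.surjective i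
    rcases i with i | i
    · have : σ.symm (.inl (finSumFinEquiv (.inl i))) = .inl (.inl i) := by
        rw [Equiv.symm_apply_eq]; rfl
      rw [Module.Basis.reindex_apply, this, hb]
      exact hl i
    · have : σ.symm (.inl (finSumFinEquiv (.inr i))) = .inr i := by
        rw [Equiv.symm_apply_eq]; rfl
      rw [Module.Basis.reindex_apply, this, hb]
      rfl
  · have : σ.symm (.inr j) = .inl (.inr j) := rfl
    rw [Module.Basis.reindex_apply, this, hb]
    exact hr j

theorem IsAngularFrame.almostContact [FiniteDimensional ℝ E] (hw : IsAngularFrame w τ)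
    {n : ℕ} (hN : IsHolomorphicComplexRiemannian n J h) :
    IsAlmostContactComplexRiemannian n (twistedTensors w τ J h) where
  smooth_φ := smoothEnd_φ hN.smooth_J
  smooth_ξ := hw.smooth_τ.tangentInl
  smooth_η := smoothForm_η hw.smooth_w
  φ_ξ q := by rw [twistedTensors_φ, tangentSnd_ξ, map_zero, map_zero]
  φ_sq q u := by
    refine hw.tangent_ext (J := J) (h := h) ?_ ?_
    · rw [twistedTensors_η_φ, map_add, map_neg, map_smul, hw.twistedTensors_η_ξ, smul_eq_mul,
        mul_one, neg_add_cancel]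
    · rw [tangentSnd_φ, tangentSnd_φ, hN.J_sq, map_add, map_neg, map_smul, tangentSnd_ξ, smul_zero,
        add_zero]
  η_φ q u := twistedTensors_η_φ q u
  η_ξ q := hw.twistedTensors_η_ξ q
  metric :=
    { smooth := smoothBilin_g hw.smooth_w hN.smooth_J hN.metric.smooth
      symm := fun q u v => by
        rw [twistedTensors_g, twistedTensors_g, J_left_eq_right hN.J_sq hN.anti_isometry,
          hN.metric.symm q.2 (tangentSnd q u), hN.metric.symm q.2 (tangentSnd q u)]
        ring
      signature := fun q => by
        obtain ⟨e, he, hl, hr⟩ := hN.metric.signature q.2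
        exact hw.signature hN.J_sq hN.anti_isometry q e he hl hr }
  compatible q u v := by
    have h1 := twistedTensors_η_φ (w := w) (τ := τ) (J := J) (h := h) q
    simp only [twistedTensors_η] at h1
    rw [twistedTensors_g, twistedTensors_g, h1, h1, tangentSnd_φ, tangentSnd_φ, hN.J_sq,
      hN.anti_isometry, map_neg, neg_apply, ← J_left_eq_right hN.J_sq hN.anti_isometry,
      twistedTensors_η, twistedTensors_η]
    ring

end Tensors

section FormApply

variable {E : Type*} [NormedAddCommGroup E] [NormedSpace ℝ E]
  {H : Type*} [TopologicalSpace H] {I : ModelWithCorners ℝ E H}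
  {M : Type*} [TopologicalSpace M] [ChartedSpace H M] [IsManifold I ∞ M]

theorem SmoothForm.mdifferentiableAt_apply {η : FormField I M} (hη : SmoothForm η)
    {Y : VecField I M} {x : M} (hY : MDiffAt (T% Y) x) : MDiffAt (fun y => η y (Y y)) x := by
  have hb : MDifferentiableAt I (I.prod 𝓘(ℝ, E →L[ℝ] ℝ))
      (fun x => TotalSpace.mk' (E →L[ℝ] ℝ) (E := fun x : M => TangentSpace I x →L[ℝ] ℝ) x (η x)) x :=
    hη.mdifferentiableAt (by simp)
  have := MDifferentiableAt.clm_bundle_apply (F₂ := ℝ) (E₂ := Bundle.Trivial M ℝ) hb hY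
  rw [mdifferentiableAt_totalSpace] at this
  exact this.2

end FormApply

section Connection

variable {E' : Type*} [NormedAddCommGroup E'] [NormedSpace ℝ E']
  {B : Type*} [TopologicalSpace B] [ChartedSpace E' B] [IsManifold 𝓘(ℝ, E') ∞ B]
  {E : Type*} [NormedAddCommGroup E] [NormedSpace ℝ E]
  {N : Type*} [TopologicalSpace N] [ChartedSpace E N] [IsManifold 𝓘(ℝ, E) ∞ N]

/-- The Levi-Civita connection of the metric of `twistedTensors`, expressed by the Levi-Civita
connection `D` of `N`. -/
def twistedNabla (w : B → ℂ) (τ : VecField 𝓘(ℝ, E') B) (J : EndField 𝓘(ℝ, E) N)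
    (h : BilinField 𝓘(ℝ, E) N)
    (D : CovariantDerivative 𝓘(ℝ, E) E (TangentSpace 𝓘(ℝ, E) : N → Type _))
    (Y : VecField (prodModels E' E) (B × N)) (q : B × N) :
    TangentSpace (prodModels E' E) q →L[ℝ] TangentSpace (prodModels E' E) q :=
  let S := twistedTensors w τ J h
  (mvfderiv (prodModels E' E) (fun r => S.η r (Y r)) q).smulRight (S.ξ q) +
    (tangentInr q).comp (pullbackConnection E' D (fun r => tangentSnd r (Y r)) q) +
    ((S.g q (Y q)).comp (S.φ q)).smulRight (S.ξ q) - S.η q (Y q) • S.φ q -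
    (S.η q).smulRight (S.φ q (Y q))

variable {w : B → ℂ} {τ : VecField 𝓘(ℝ, E') B} {J : EndField 𝓘(ℝ, E) N}
  {h : BilinField 𝓘(ℝ, E) N}
  {D : CovariantDerivative 𝓘(ℝ, E) E (TangentSpace 𝓘(ℝ, E) : N → Type _)}

omit [IsManifold 𝓘(ℝ, E') ∞ B] in
theorem twistedNabla_apply (Y : VecField (prodModels E' E) (B × N)) (q : B × N)
    (u : TangentSpace (prodModels E' E) q) :
    twistedNabla w τ J h D Y q u =
      mvfderiv (prodModels E' E) (fun r => (twistedTensors w τ J h).η r (Y r)) q u •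
          (twistedTensors w τ J h).ξ q +
        tangentInr q (pullbackConnection E' D (fun r => tangentSnd r (Y r)) q u) +
        (twistedTensors w τ J h).g q (Y q) ((twistedTensors w τ J h).φ q u) •
          (twistedTensors w τ J h).ξ q -
        (twistedTensors w τ J h).η q (Y q) • (twistedTensors w τ J h).φ q u -
        (twistedTensors w τ J h).η q u • (twistedTensors w τ J h).φ q (Y q) := rfl

variable {q : B × N}

theorem IsAngularFrame.η_twistedNabla (hw : IsAngularFrame w τ)
    (Y : VecField (prodModels E' E) (B × N)) (u : TangentSpace (prodModels E' E) q) :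
    (twistedTensors w τ J h).η q (twistedNabla w τ J h D Y q u) =
      mvfderiv (prodModels E' E) (fun r => (twistedTensors w τ J h).η r (Y r)) q u +
        (twistedTensors w τ J h).g q (Y q) ((twistedTensors w τ J h).φ q u) := by
  simp [twistedNabla_apply, hw.twistedTensors_η_ξ]

omit [IsManifold 𝓘(ℝ, E') ∞ B] in
theorem tangentSnd_twistedNabla
    (Y : VecField (prodModels E' E) (B × N)) (u : TangentSpace (prodModels E' E) q) :
    tangentSnd q (twistedNabla w τ J h D Y q u) =
      pullbackConnection E' D (fun r => tangentSnd r (Y r)) q u -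
        (twistedTensors w τ J h).η q (Y q) • J q.2 (tangentSnd q u) -
        (twistedTensors w τ J h).η q u • J q.2 (tangentSnd q (Y q)) := by
  simp [twistedNabla_apply]

theorem isCovariantDerivativeOn_twistedNabla (hw : IsAngularFrame w τ) :
    IsCovariantDerivativeOn (E' × E)
      (V := (TangentSpace (prodModels E' E) : B × N → Type _)) (twistedNabla w τ J h D) where
  add {Y Z q} hY hZ _ := by
    have hη := smoothForm_η (τ := τ) (J := J) (h := h) hw.smooth_w
    have h1 := mvfderiv_fun_add (hη.mdifferentiableAt_apply hY) (hη.mdifferentiableAt_apply hZ)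
    have h2 := pullbackConnection_add (D := D) (sndDiffAt_tangentSnd hY) (sndDiffAt_tangentSnd hZ)
    refine ContinuousLinearMap.ext fun u => ?_
    simp only [add_apply, twistedNabla_apply, Pi.add_apply, map_add, h1, h2, add_smul, smul_add]
    abel
  leibniz {Y f q} hY hf _ := by
    have hη := smoothForm_η (τ := τ) (J := J) (h := h) hw.smooth_w
    refine ContinuousLinearMap.ext fun u => ?_
    have h1 : mvfderiv (prodModels E' E)
        (fun r => f r * (twistedTensors w τ J h).η r (Y r)) q u =
        f q * mvfderiv (prodModels E' E) (fun r => (twistedTensors w τ J h).η r (Y r)) q u +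
          mvfderiv (prodModels E' E) f q u * (twistedTensors w τ J h).η q (Y q) := by
      have h3 := mvfderiv_mul hf (hη.mdifferentiableAt_apply hY)
      refine congr($h3 u).trans ?_
      simp only [add_apply, smul_apply, smul_eq_mul]
      ring
    have h2 := pullbackConnection_smul (D := D) hf (sndDiffAt_tangentSnd hY) u
    simp only [add_apply, twistedNabla_apply, Pi.smul_apply', map_smul, smul_eq_mul, h1, h2,
      smul_apply, ContinuousLinearMap.smulRight_apply, map_add]
    rw [← hw.smul_ξ_add_inr (J := J) (h := h) q (Y q)]
    simp [hw.twistedTensors_η_ξ]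
    module

/-- The connection `twistedNabla`, as a covariant derivative. -/
def IsAngularFrame.connection (hw : IsAngularFrame w τ) (J : EndField 𝓘(ℝ, E) N)
    (h : BilinField 𝓘(ℝ, E) N)
    (D : CovariantDerivative 𝓘(ℝ, E) E (TangentSpace 𝓘(ℝ, E) : N → Type _)) :
    CovariantDerivative (prodModels E' E) (E' × E)
      (TangentSpace (prodModels E' E) : B × N → Type _) where
  toFun := twistedNabla w τ J h D
  isCovariantDerivativeOnUniv := isCovariantDerivativeOn_twistedNabla hw

theorem IsAngularFrame.connection_apply (hw : IsAngularFrame w τ)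
    (Y : VecField (prodModels E' E) (B × N)) :
    hw.connection J h D Y q = twistedNabla w τ J h D Y q := rfl

omit [IsManifold 𝓘(ℝ, E') ∞ B] [IsManifold 𝓘(ℝ, E) ∞ N] in
theorem twistedTensors_g_φ_right (hJ : ∀ p u, J p (J p u) = -u)
    (hh : ∀ p u v, h p (J p u) (J p v) = -h p u v) (u v : TangentSpace (prodModels E' E) q) :
    (twistedTensors w τ J h).g q u ((twistedTensors w τ J h).φ q v) =
      (w q.1).re * h q.2 (J q.2 (tangentSnd q u)) (tangentSnd q v) +
        (w q.1).im * h q.2 (tangentSnd q u) (tangentSnd q v) := by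
  have h1 := twistedTensors_η_φ (w := w) (τ := τ) (J := J) (h := h) q v
  rw [twistedTensors_η] at h1
  rw [twistedTensors_g, h1, tangentSnd_φ, hh, ← J_left_eq_right hJ hh]
  ring

theorem IsAngularFrame.η_mlieBracket [FiniteDimensional ℝ E] [FiniteDimensional ℝ E']
    (hw : IsAngularFrame w τ) {X Y : VecField (prodModels E' E) (B × N)}
    (hX : MDiffAt (T% X) q) (hY : MDiffAt (T% Y) q) :
    (twistedTensors w τ J h).η q (VectorField.mlieBracket (prodModels E' E) X Y q) =
      mvfderiv (prodModels E' E) (fun r => (twistedTensors w τ J h).η r (Y r)) q (X q) -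
        mvfderiv (prodModels E' E) (fun r => (twistedTensors w τ J h).η r (X r)) q (Y q) := by
  have hη := smoothForm_η (τ := τ) (J := J) (h := h) hw.smooth_w
  have hf : ContMDiff (prodModels E' E) 𝓘(ℝ, ℂ) ∞ (fun r : B × N => w r.1) :=
    hw.smooth_w.comp contMDiff_fst
  have hd : ∀ (r : B × N) (u : TangentSpace (prodModels E' E) r),
      mvfderiv (prodModels E' E) (fun r : B × N => w r.1) r u =
        (twistedTensors w τ J h).η r u • (2 * Complex.I * w r.1) := fun r u => by
    rw [mvfderiv_comp_fst (hw.smooth_w.mdifferentiableAt (by simp)), hw.mvfderiv_w,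
      twistedTensors_η]
  have key := mvfderiv_mlieBracket ((hf q).of_le (by norm_cast)) hX hY
  have hZ : ∀ {Z : VecField (prodModels E' E) (B × N)}, MDiffAt (T% Z) q → ∀ u,
      mvfderiv (prodModels E' E) (fun r => (twistedTensors w τ J h).η r (Z r) •
        (2 * Complex.I * w r.1)) q u =
      mvfderiv (prodModels E' E) (fun r => (twistedTensors w τ J h).η r (Z r)) q u •
          (2 * Complex.I * w q.1) +
        ((twistedTensors w τ J h).η q (Z q) * (twistedTensors w τ J h).η q u) •
          (2 * Complex.I * (2 * Complex.I * w q.1)) := by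
    intro Z hZ u
    have hm : MDifferentiableAt (prodModels E' E) 𝓘(ℝ, ℂ) (fun r : B × N => w r.1) q :=
      (hf q).mdifferentiableAt (by simp)
    let L : ℂ →L[ℝ] ℂ := ContinuousLinearMap.mul ℝ ℂ (2 * Complex.I)
    have hL : MDifferentiableAt 𝓘(ℝ, ℂ) 𝓘(ℝ, ℂ) L (w q.1) := L.mdifferentiableAt
    have h1 : mvfderiv (prodModels E' E) (fun r : B × N => 2 * Complex.I * w r.1) q u =
        2 * Complex.I * mvfderiv (prodModels E' E) (fun r : B × N => w r.1) q u := by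
      refine (mfderiv_comp_apply (I' := 𝓘(ℝ, ℂ)) q (g := L) hL hm u).trans ?_
      rw [L.mfderiv_eq]
      rfl
    have h2 := mvfderiv_smul (hη.mdifferentiableAt_apply hZ)
      (MDifferentiableAt.comp (I' := 𝓘(ℝ, ℂ)) q (g := L) hL hm)
    refine congr($h2 u).trans ?_
    refine (congrArg₂ (· + ·) (congrArg ((twistedTensors w τ J h).η q (Z q) • ·) h1) rfl).trans ?_
    rw [hd, mul_smul_comm, smul_smul, add_comm]
    rfl
  simp only [hd] at key
  rw [hZ hX, hZ hY] at key
  have hne : 2 * Complex.I * w q.1 ≠ 0 := by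
    have := hw.conj_mul q.1
    refine mul_ne_zero (by simp) fun h0 => ?_
    simp [h0] at this
  refine smul_left_injective ℝ hne ?_
  dsimp only
  rw [key, sub_smul, mul_comm ((twistedTensors w τ J h).η q (X q))]
  abel

theorem IsAngularFrame.torsion_free [FiniteDimensional ℝ E] [FiniteDimensional ℝ E']
    (hw : IsAngularFrame w τ) (hJ : ∀ p u, J p (J p u) = -u)
    (hh : ∀ p u v, h p (J p u) (J p v) = -h p u v)
    (hD : ∀ (X Y : VecField 𝓘(ℝ, E) N) (x : N), MDiffAt (T% X) x → MDiffAt (T% Y) x →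
      D Y x (X x) - D X x (Y x) = VectorField.mlieBracket 𝓘(ℝ, E) X Y x)
    {X Y : VecField (prodModels E' E) (B × N)}
    (hs : ∀ p u v, h p u v = h p v u)
    (hX : MDiffAt (T% X) q) (hY : MDiffAt (T% Y) q) :
    twistedNabla w τ J h D Y q (X q) - twistedNabla w τ J h D X q (Y q) =
      VectorField.mlieBracket (prodModels E' E) X Y q := by
  refine hw.tangent_ext (J := J) (h := h) ?_ ?_
  · rw [map_sub, hw.η_twistedNabla, hw.η_twistedNabla, hw.η_mlieBracket hX hY,
      twistedTensors_g_φ_right hJ hh, twistedTensors_g_φ_right hJ hh, J_left_eq_right hJ hh,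
      hs q.2 (tangentSnd q (Y q)), hs q.2 (tangentSnd q (Y q))]
    ring
  · rw [map_sub, tangentSnd_twistedNabla, tangentSnd_twistedNabla, tangentSnd_mlieBracket hD hX hY]
    abel

theorem IsAngularFrame.metric_compatible (hw : IsAngularFrame w τ) (hJs : SmoothEnd J)
    (hhs : SmoothBilin h) (hJ : ∀ p u, J p (J p u) = -u)
    (hh : ∀ p u v, h p (J p u) (J p v) = -h p u v) (hs : ∀ p u v, h p u v = h p v u)
    (hD : ∀ (Y Z : VecField 𝓘(ℝ, E) N) (x : N), MDiffAt (T% Y) x → MDiffAt (T% Z) x →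
      ∀ u : TangentSpace 𝓘(ℝ, E) x, mvfderiv 𝓘(ℝ, E) (fun y => h y (Y y) (Z y)) x u =
        h x (D Y x u) (Z x) + h x (Y x) (D Z x u))
    (hDJ : ∀ (Y : VecField 𝓘(ℝ, E) N) (x : N), MDiffAt (T% Y) x →
      ∀ u : TangentSpace 𝓘(ℝ, E) x, nablaEnd D J Y x u = 0)
    {Y Z : VecField (prodModels E' E) (B × N)}
    (hY : MDiffAt (T% Y) q) (hZ : MDiffAt (T% Z) q) (u : TangentSpace (prodModels E' E) q) :
    mvfderiv (prodModels E' E) (fun r => (twistedTensors w τ J h).g r (Y r) (Z r)) q u =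
      (twistedTensors w τ J h).g q (twistedNabla w τ J h D Y q u) (Z q) +
        (twistedTensors w τ J h).g q (Y q) (twistedNabla w τ J h D Z q u) := by
  have hη := smoothForm_η (τ := τ) (J := J) (h := h) hw.smooth_w
  have hY₂ := sndDiffAt_tangentSnd hY
  have hZ₂ := sndDiffAt_tangentSnd hZ
  have hw₁ := hw.smooth_w.mdifferentiableAt (x := q.1) (by simp)
  have hre : MDifferentiableAt 𝓘(ℝ, E') 𝓘(ℝ, ℝ) (fun s => (w s).re) q.1 :=
    Complex.reCLM.mdifferentiableAt.comp (I' := 𝓘(ℝ, ℂ)) q.1 hw₁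
  have him : MDifferentiableAt 𝓘(ℝ, E') 𝓘(ℝ, ℝ) (fun s => (w s).im) q.1 :=
    Complex.imCLM.mdifferentiableAt.comp (I' := 𝓘(ℝ, ℂ)) q.1 hw₁
  have hre' : MDifferentiableAt (prodModels E' E) 𝓘(ℝ, ℝ) (fun r : B × N => (w r.1).re) q :=
    hre.comp (I' := 𝓘(ℝ, E')) q mdifferentiableAt_fst
  have him' : MDifferentiableAt (prodModels E' E) 𝓘(ℝ, ℝ) (fun r : B × N => (w r.1).im) q :=
    him.comp (I' := 𝓘(ℝ, E')) q mdifferentiableAt_fst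
  have hηY := hη.mdifferentiableAt_apply hY
  have hηZ := hη.mdifferentiableAt_apply hZ
  have hb := hY₂.bilin hhs hZ₂
  have hb' := (hY₂.endo hJs).bilin hhs hZ₂
  have h1 : mvfderiv (prodModels E' E) (fun r => (twistedTensors w τ J h).g r (Y r) (Z r)) q = _ :=
    (mvfderiv_fun_sub ((hηY.mul hηZ).add (hre'.mul hb)) (him'.mul hb')).trans
      (congrArg₂ (· - ·) ((mvfderiv_fun_add (hηY.mul hηZ) (hre'.mul hb)).trans
        (congrArg₂ (· + ·) (mvfderiv_mul hηY hηZ) (mvfderiv_mul hre' hb))) (mvfderiv_mul him' hb'))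
  rw [h1]
  simp only [add_apply, sub_apply, smul_apply, smul_eq_mul]
  rw [pullbackConnection_metric hhs hD hY₂ hZ₂, pullbackConnection_metric hhs hD (hY₂.endo hJs) hZ₂,
    pullbackConnection_endo hDJ hY₂, mvfderiv_comp_fst hre, mvfderiv_comp_fst him, hw.mvfderiv_re,
    hw.mvfderiv_im]
  have hg : ∀ a b : TangentSpace (prodModels E' E) q, (twistedTensors w τ J h).g q a b =
      (twistedTensors w τ J h).η q a * (twistedTensors w τ J h).η q b +
        (w q.1).re * h q.2 (tangentSnd q a) (tangentSnd q b) -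
        (w q.1).im * h q.2 (J q.2 (tangentSnd q a)) (tangentSnd q b) := twistedTensors_g q
  have hu : argForm 𝓘(ℝ, E') w q.1 (tangentFst q u) = (twistedTensors w τ J h).η q u := rfl
  have hJl := J_left_eq_right hJ hh
  have e₁ : h q.2 (J q.2 (tangentSnd q (Z q))) (tangentSnd q u) =
      h q.2 (J q.2 (tangentSnd q u)) (tangentSnd q (Z q)) := by rw [hJl, hs]
  have e₂ := hs q.2 (tangentSnd q (Z q)) (tangentSnd q u)
  rw [hg, hg, hw.η_twistedNabla, hw.η_twistedNabla, twistedTensors_g_φ_right hJ hh,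
    twistedTensors_g_φ_right hJ hh, tangentSnd_twistedNabla, tangentSnd_twistedNabla, hu]
  simp only [map_sub, map_smul, sub_apply, smul_apply, smul_eq_mul, hJ, map_neg, neg_apply, hh,
    ← hJl, smul_neg, e₁, e₂]
  ring

theorem IsAngularFrame.nablaEnd_φ (hw : IsAngularFrame w τ)
    (hJ : ∀ p u, J p (J p u) = -u)
    (hDJ : ∀ (Y : VecField 𝓘(ℝ, E) N) (x : N), MDiffAt (T% Y) x →
      ∀ u : TangentSpace 𝓘(ℝ, E) x, nablaEnd D J Y x u = 0)
    {Y : VecField (prodModels E' E) (B × N)}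
    (hY : MDiffAt (T% Y) q) (u : TangentSpace (prodModels E' E) q) :
    nablaEnd (hw.connection J h D) (twistedTensors w τ J h).φ Y q u =
      (twistedTensors w τ J h).g q ((twistedTensors w τ J h).φ q (Y q))
          ((twistedTensors w τ J h).φ q u) • (twistedTensors w τ J h).ξ q +
        (twistedTensors w τ J h).η q (Y q) •
          (twistedTensors w τ J h).φ q ((twistedTensors w τ J h).φ q u) := by
  refine hw.tangent_ext (J := J) (h := h) ?_ ?_
  · have h0 : mvfderiv (prodModels E' E) (fun r => (twistedTensors w τ J h).η r
        ((twistedTensors w τ J h).φ r (Y r))) q = 0 := by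
      simp only [twistedTensors_η_φ]
      exact mvfderiv_const 0
    rw [nablaEnd, hw.connection_apply, hw.connection_apply, map_sub, hw.η_twistedNabla, h0,
      twistedTensors_η_φ, map_add, map_smul, map_smul, hw.twistedTensors_η_ξ, twistedTensors_η_φ]
    simp
  · rw [nablaEnd, hw.connection_apply, hw.connection_apply, map_sub, tangentSnd_twistedNabla,
      tangentSnd_φ, tangentSnd_φ, tangentSnd_twistedNabla]
    simp only [tangentSnd_φ, twistedTensors_η_φ, map_add, map_sub, map_smul, tangentSnd_ξ]
    rw [pullbackConnection_endo hDJ (sndDiffAt_tangentSnd hY)]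
    simp only [hJ]
    module

theorem IsAngularFrame.isSasakiLike [FiniteDimensional ℝ E] [FiniteDimensional ℝ E']
    (hw : IsAngularFrame w τ) {n : ℕ} (hN : IsHolomorphicComplexRiemannian n J h) :
    IsSasakiLike n (twistedTensors w τ J h) := by
  obtain ⟨D, hD, hDJ⟩ := hN.parallel
  have hac := hw.almostContact hN
  have hξ : ∀ q (u : TangentSpace (prodModels E' E) q),
      (twistedTensors w τ J h).g q ((twistedTensors w τ J h).ξ q) u =
        (twistedTensors w τ J h).η q u := fun q u => by
    have h1 := hac.compatible q ((twistedTensors w τ J h).ξ q) u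
    rw [hac.φ_ξ, map_zero, zero_apply, hac.η_ξ] at h1
    linarith
  have hφ := fun (q : B × N) (Y : VecField (prodModels E' E) (B × N)) (hY : MDiffAt (T% Y) q) u =>
    hw.nablaEnd_φ (h := h) (D := D) hN.J_sq hDJ hY u
  refine { hac with sasaki := ⟨hw.connection J h D, ⟨fun X Y q hX hY => ?_, fun Y Z q hY hZ u => ?_⟩,
    fun q Y hY hηY => ⟨fun u v hu hv => ?_, fun v hv => ?_, fun u hu => ?_⟩, fun q v hv => ?_⟩ }
  · exact hw.torsion_free hN.J_sq hN.anti_isometry hD.torsion_free hN.metric.symm hX hY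
  · exact hw.metric_compatible hN.smooth_J hN.metric.smooth hN.J_sq hN.anti_isometry
      hN.metric.symm hD.metric hDJ hY hZ u
  · rw [fundamentalTensor, hφ q Y hY, hηY, zero_smul, add_zero, map_smul, smul_apply, hξ, hv,
      smul_zero]
  · rw [fundamentalTensor, hφ q Y hY, hηY, zero_smul, add_zero, map_smul, smul_apply, hξ, hv,
      smul_zero]
  · rw [fundamentalTensor, hφ q Y hY, hηY, zero_smul, add_zero, map_smul, smul_apply, hξ, hac.η_ξ,
      hac.compatible, hηY, zero_mul, add_zero, hac.metric.symm, smul_eq_mul, mul_one]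
  · rw [fundamentalTensor, hφ q _ (hac.smooth_ξ.mdifferentiableAt (by simp)), hac.φ_ξ, map_zero,
      map_zero, zero_smul, zero_add, smul_zero, map_zero, zero_apply]

end Connection

section Descent

variable {E₁ : Type*} [NormedAddCommGroup E₁] [NormedSpace ℝ E₁]
  {B₁ : Type*} [TopologicalSpace B₁] [ChartedSpace E₁ B₁] [IsManifold 𝓘(ℝ, E₁) ∞ B₁]
  {E₂ : Type*} [NormedAddCommGroup E₂] [NormedSpace ℝ E₂]
  {B₂ : Type*} [TopologicalSpace B₂] [ChartedSpace E₂ B₂] [IsManifold 𝓘(ℝ, E₂) ∞ B₂]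
  {E : Type*} [NormedAddCommGroup E] [NormedSpace ℝ E]
  {N : Type*} [TopologicalSpace N] [ChartedSpace E N]
  {c : B₁ → B₂}

omit [IsManifold 𝓘(ℝ, E₁) ∞ B₁] [IsManifold 𝓘(ℝ, E₂) ∞ B₂] in
theorem tangentFst_mfderiv_map (hc : MDifferentiable 𝓘(ℝ, E₁) 𝓘(ℝ, E₂) c) (q : B₁ × N)
    (u : TangentSpace (prodModels E₁ E) q) :
    tangentFst (E := E) (c q.1, q.2)
        (mfderiv (prodModels E₁ E) (prodModels E₂ E) (fun r : B₁ × N => (c r.1, r.2)) q u) =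
      mfderiv 𝓘(ℝ, E₁) 𝓘(ℝ, E₂) c q.1 (tangentFst q u) := by
  have h1 : MDifferentiableAt (prodModels E₁ E) 𝓘(ℝ, E₂) (fun r : B₁ × N => c r.1) q :=
    (hc q.1).comp (I' := 𝓘(ℝ, E₁)) q mdifferentiableAt_fst
  have h2 : MDifferentiableAt (prodModels E₁ E) (prodModels E₂ E)
      (fun r : B₁ × N => (c r.1, r.2)) q := h1.prodMk mdifferentiableAt_snd
  refine (mfderiv_comp_apply (I' := prodModels E₂ E) q (g := Prod.fst) mdifferentiableAt_fst h2
    u).symm.trans ?_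
  exact mfderiv_comp_apply (I' := 𝓘(ℝ, E₁)) q (g := c) (hc q.1) mdifferentiableAt_fst u

omit [IsManifold 𝓘(ℝ, E₁) ∞ B₁] [IsManifold 𝓘(ℝ, E₂) ∞ B₂] in
theorem tangentSnd_mfderiv_map (hc : MDifferentiable 𝓘(ℝ, E₁) 𝓘(ℝ, E₂) c) (q : B₁ × N)
    (u : TangentSpace (prodModels E₁ E) q) :
    tangentSnd (E := E) (c q.1, q.2)
        (mfderiv (prodModels E₁ E) (prodModels E₂ E) (fun r : B₁ × N => (c r.1, r.2)) q u) =
      tangentSnd q u := by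
  have h1 : MDifferentiableAt (prodModels E₁ E) 𝓘(ℝ, E₂) (fun r : B₁ × N => c r.1) q :=
    (hc q.1).comp (I' := 𝓘(ℝ, E₁)) q mdifferentiableAt_fst
  have h2 : MDifferentiableAt (prodModels E₁ E) (prodModels E₂ E)
      (fun r : B₁ × N => (c r.1, r.2)) q := h1.prodMk mdifferentiableAt_snd
  exact (mfderiv_comp_apply (I' := prodModels E₂ E) q (g := Prod.snd) mdifferentiableAt_snd h2
    u).symm

variable {w₁ : B₁ → ℂ} {τ₁ : VecField 𝓘(ℝ, E₁) B₁} {w₂ : B₂ → ℂ} {τ₂ : VecField 𝓘(ℝ, E₂) B₂}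

omit [IsManifold 𝓘(ℝ, E₁) ∞ B₁] in
theorem IsAngularFrame.argForm_mfderiv (h₂ : IsAngularFrame w₂ τ₂)
    (hc : MDifferentiable 𝓘(ℝ, E₁) 𝓘(ℝ, E₂) c) (hcw : ∀ t, w₂ (c t) = w₁ t) (t : B₁)
    (v : TangentSpace 𝓘(ℝ, E₁) t) :
    argForm 𝓘(ℝ, E₂) w₂ (c t) (mfderiv 𝓘(ℝ, E₁) 𝓘(ℝ, E₂) c t v) = argForm 𝓘(ℝ, E₁) w₁ t v := by
  obtain rfl : (fun t => w₂ (c t)) = w₁ := funext hcw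
  have h1 : mvfderiv 𝓘(ℝ, E₁) (fun t => w₂ (c t)) t v =
      mvfderiv 𝓘(ℝ, E₂) w₂ (c t) (mfderiv 𝓘(ℝ, E₁) 𝓘(ℝ, E₂) c t v) :=
    mfderiv_comp_apply (I' := 𝓘(ℝ, E₂)) t (g := w₂) (h₂.smooth_w.mdifferentiableAt (by simp)) (hc t) v
  rw [argForm_apply, argForm_apply, h1]

theorem IsAngularFrame.descendsTo (h₁ : IsAngularFrame w₁ τ₁) (h₂ : IsAngularFrame w₂ τ₂)
    (hc : MDifferentiable 𝓘(ℝ, E₁) 𝓘(ℝ, E₂) c) (hcw : ∀ t, w₂ (c t) = w₁ t)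
    (J : EndField 𝓘(ℝ, E) N) (h : BilinField 𝓘(ℝ, E) N) :
    DescendsTo (twistedTensors w₁ τ₁ J h) (fun r : B₁ × N => (c r.1, r.2))
      (twistedTensors w₂ τ₂ J h) where
  φ q u := by
    refine tangent_prod_ext ?_ ?_
    · rw [tangentFst_mfderiv_map hc, twistedTensors_φ, twistedTensors_φ, tangentFst_inr,
        tangentFst_inr, map_zero]
    · rw [tangentSnd_mfderiv_map hc, tangentSnd_φ, tangentSnd_φ, tangentSnd_mfderiv_map hc]
  ξ q := by
    refine tangent_prod_ext ?_ ?_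
    · rw [tangentFst_mfderiv_map hc, twistedTensors_ξ, twistedTensors_ξ, tangentFst_inl,
        tangentFst_inl]
      exact h₂.ext_argForm ((h₂.argForm_mfderiv hc hcw q.1 _).trans
        ((h₁.argForm_τ q.1).trans (h₂.argForm_τ (c q.1)).symm))
    · rw [tangentSnd_mfderiv_map hc, tangentSnd_ξ, tangentSnd_ξ]
  η q u := by
    rw [twistedTensors_η, twistedTensors_η, tangentFst_mfderiv_map hc, h₂.argForm_mfderiv hc hcw]
  g q u v := by
    rw [twistedTensors_g, twistedTensors_g, tangentFst_mfderiv_map hc, tangentFst_mfderiv_map hc,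
      tangentSnd_mfderiv_map hc, tangentSnd_mfderiv_map hc, h₂.argForm_mfderiv hc hcw,
      h₂.argForm_mfderiv hc hcw, hcw]

end Descent

section ConstantFields

variable {E : Type*} [NormedAddCommGroup E] [NormedSpace ℝ E]
  {H : Type*} [TopologicalSpace H] {I : ModelWithCorners ℝ E H}
  {M : Type*} [TopologicalSpace M] [ChartedSpace H M] [IsManifold I ∞ M]

/-- On a manifold whose preferred charts agree, the constant vector fields are smooth. -/
theorem smoothVec_const [I.Boundaryless]
    (hM : ∀ x y : M, (extChartAt I x : M → E) = extChartAt I y) (v : E) :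
    SmoothVec (fun x : M => (tangentModel I x).symm v) := by
  intro x₀
  have : IsManifold I 1 M := inferInstance
  rw [contMDiffAt_section]
  refine (contMDiffAt_const (c := v)).congr_of_eventuallyEq ?_
  filter_upwards [(chartAt H x₀).open_source.mem_nhds (mem_chart_source H x₀)] with x hx
  have h1 := TangentBundle.continuousLinearMapAt_trivializationAt (I := I) (𝕜 := ℝ) hx
  have h2 : mfderiv I 𝓘(ℝ, E) (extChartAt I x₀) x = (tangentModel I x : TangentSpace I x →L[ℝ] E) := by
    rw [hM x₀ x]
    exact mvfderiv_extChartAt_self x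
  rw [h2] at h1
  have hx' : x ∈ (trivializationAt E (TangentSpace I : M → Type _) x₀).baseSet := hx
  exact (Bundle.Trivialization.continuousLinearMapAt_apply_of_mem ℝ _ hx' _).symm.trans
    congr($h1 ((tangentModel I x).symm v))

end ConstantFields

section HalfLine

/-- The function `exp (2it)` on the half-line. -/
def halfLineRotation (t : PosReal) : ℂ := Complex.exp (2 * Complex.I * (t : ℝ))

theorem contDiff_rotation : ContDiff ℝ ∞ (fun t : ℝ => Complex.exp (2 * Complex.I * t)) :=
  (contDiff_const.mul Complex.ofRealCLM.contDiff).cexp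

theorem fderiv_rotation (t a : ℝ) :
    fderiv ℝ (fun t : ℝ => Complex.exp (2 * Complex.I * t)) t a =
      a • (2 * Complex.I * Complex.exp (2 * Complex.I * t)) := by
  have h1 : HasDerivAt (fun t : ℝ => Complex.exp (2 * Complex.I * t))
      (Complex.exp (2 * Complex.I * t) * (2 * Complex.I * 1)) t :=
    (((hasDerivAt_id t).ofReal_comp).const_mul (2 * Complex.I)).cexp
  rw [h1.hasFDerivAt.fderiv, ContinuousLinearMap.toSpanSingleton_apply, mul_one, mul_comm]

theorem mvfderiv_coe_posReal (t : PosReal) :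
    mvfderiv 𝓘(ℝ, ℝ) (fun s : PosReal => (s : ℝ)) t = tangentModel 𝓘(ℝ, ℝ) t :=
  mvfderiv_extChartAt_self (I := 𝓘(ℝ, ℝ)) t

theorem mdifferentiable_coe_posReal :
    MDifferentiable 𝓘(ℝ, ℝ) 𝓘(ℝ, ℝ) (fun s : PosReal => (s : ℝ)) :=
  (contMDiff_subtype_val (n := ∞)).mdifferentiable (by simp)

theorem isAngularFrame_halfLine :
    IsAngularFrame (E' := ℝ) halfLineRotation
      (fun t => (tangentModel 𝓘(ℝ, ℝ) t).symm 1) where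
  smooth_w := contDiff_rotation.contMDiff.comp contMDiff_subtype_val
  conj_mul t := by
    rw [halfLineRotation, ← Complex.exp_conj, ← Complex.exp_add]
    simp [Complex.conj_ofNat]
  smooth_τ := smoothVec_const (fun x y => rfl) 1
  deriv_τ t := by
    have h1 := mfderiv_comp_apply (I' := 𝓘(ℝ, ℝ)) (I'' := 𝓘(ℝ, ℂ)) t
      (g := fun t : ℝ => Complex.exp (2 * Complex.I * t))
      (contDiff_rotation.contMDiff.mdifferentiable (by simp) _) (mdifferentiable_coe_posReal t)
      ((tangentModel 𝓘(ℝ, ℝ) t).symm 1)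
    refine h1.trans ?_
    rw [mfderiv_eq_fderiv]
    refine (congrArg (fderiv ℝ (fun t : ℝ => Complex.exp (2 * Complex.I * t)) t)
      congr($(mvfderiv_coe_posReal t) ((tangentModel 𝓘(ℝ, ℝ) t).symm 1))).trans ?_
    exact (fderiv_rotation t 1).trans (one_smul ℝ _)
  span t v := ⟨tangentModel 𝓘(ℝ, ℝ) t v, by
    rw [← map_smul, smul_eq_mul, mul_one, ContinuousLinearEquiv.symm_apply_apply]⟩

variable {E : Type*} [NormedAddCommGroup E] [NormedSpace ℝ E]
  {N : Type*} [TopologicalSpace N] [ChartedSpace E N]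

theorem solvableExtension_eq (J : EndField 𝓘(ℝ, E) N) (h : BilinField 𝓘(ℝ, E) N) :
    solvableExtension J h =
      twistedTensors halfLineRotation (fun t => (tangentModel 𝓘(ℝ, ℝ) t).symm 1) J h := by
  have h1 : ∀ (t : PosReal) (v : TangentSpace 𝓘(ℝ, ℝ) t),
      argForm 𝓘(ℝ, ℝ) halfLineRotation t v = tangentModel 𝓘(ℝ, ℝ) t v := fun t v => by
    have := congrArg (tangentModel 𝓘(ℝ, ℝ) t) (isAngularFrame_halfLine.argForm_smul_τ t v)
    rwa [map_smul, ContinuousLinearEquiv.apply_symm_apply, smul_eq_mul, mul_one] at this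
  have h2 : (dt : FormField (prodModel E) (PosReal × N)) =
      (twistedTensors halfLineRotation (fun t => (tangentModel 𝓘(ℝ, ℝ) t).symm 1) J h).η := by
    funext q
    refine ContinuousLinearMap.ext fun u => ?_
    rw [twistedTensors_η, h1]
    exact (mvfderiv_comp_fst (mdifferentiable_coe_posReal q.1) u).trans
      congr($(mvfderiv_coe_posReal q.1) _)
  have h3 : ∀ q : PosReal × N, Real.cos (2 * (q.1 : ℝ)) = (halfLineRotation q.1).re ∧
      Real.sin (2 * (q.1 : ℝ)) = (halfLineRotation q.1).im := fun q => by
    have : halfLineRotation q.1 = Complex.exp ((2 * (q.1 : ℝ) : ℝ) * Complex.I) := by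
      rw [halfLineRotation]
      push_cast
      ring_nf
    rw [this, Complex.exp_ofReal_mul_I_re, Complex.exp_ofReal_mul_I_im]
    exact ⟨rfl, rfl⟩
  have h4 : (solvableExtension J h).g =
      (twistedTensors halfLineRotation (fun t => (tangentModel 𝓘(ℝ, ℝ) t).symm 1) J h).g := by
    funext q
    refine ContinuousLinearMap.ext fun u => ContinuousLinearMap.ext fun v => ?_
    change dt q u * dt q v + Real.cos (2 * (q.1 : ℝ)) * _ - Real.sin (2 * (q.1 : ℝ)) * _ = _
    rw [h2, (h3 q).1, (h3 q).2]
    rfl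
  have h5 : ∀ S T : ContactTensors (prodModel E) (PosReal × N),
      S.φ = T.φ → S.ξ = T.ξ → S.η = T.η → S.g = T.g → S = T := by
    rintro ⟨_, _, _, _⟩ ⟨_, _, _, _⟩ rfl rfl rfl rfl
    rfl
  exact h5 _ _ rfl rfl h2 h4

end HalfLine

section CircleFrame

/-- The rotation of the circle by the angle `2s/k`. -/
def circleFlow (k : ℕ) (q : ℝ × Circle) : Circle := Circle.exp (2 * q.1 / k) * q.2

/-- The function `z ^ k` on the circle. -/
def circlePow (k : ℕ) (z : Circle) : ℂ := (z : ℂ) ^ k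

/-- The velocity field of `circleFlow`. -/
def circleField (k : ℕ) : VecField (𝓡 1) Circle := fun z =>
  (tangentModel (𝓡 1) z).symm (tangentModel (𝓡 1) (circleFlow k (0, z))
    (mfderiv (prodModels ℝ (EuclideanSpace ℝ (Fin 1))) (𝓡 1) (circleFlow k) (0, z)
      (tangentInl (0, z) ((tangentModel 𝓘(ℝ, ℝ) (0 : ℝ)).symm 1))))

theorem contMDiff_circleFlow (k : ℕ) :
    ContMDiff (prodModels ℝ (EuclideanSpace ℝ (Fin 1))) (𝓡 1) ∞ (circleFlow k) := by
  have h1 : ContDiff ℝ ∞ (fun s : ℝ => 2 * s / k) := (contDiff_const.mul contDiff_id).div_const _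
  exact ((contMDiff_circleExp.comp h1.contMDiff).comp contMDiff_fst).mul contMDiff_snd

theorem contMDiff_circlePow (k : ℕ) : ContMDiff (𝓡 1) 𝓘(ℝ, ℂ) ∞ (circlePow k) := by
  have h1 : ContDiff ℝ ∞ (fun z : ℂ => z ^ k) := contDiff_id.pow k
  have := finrank_real_complex_fact'
  have h2 : ContMDiff (𝓡 1) 𝓘(ℝ, ℂ) ∞ (fun z : Circle => (z : ℂ)) :=
    contMDiff_coe_sphere (E := ℂ) (n := 1)
  exact h1.contMDiff.comp h2

theorem circleFlow_zero (k : ℕ) (z : Circle) : circleFlow k (0, z) = z := by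
  simp [circleFlow]

theorem circlePow_exp {k : ℕ} (hk : 0 < k) (t : ℝ) :
    circlePow k (Circle.exp (2 * t / k)) = Complex.exp (2 * Complex.I * t) := by
  have : (k : ℂ) ≠ 0 := by exact_mod_cast hk.ne'
  rw [circlePow, Circle.coe_exp, ← Complex.exp_nat_mul]
  congr 1
  push_cast
  field_simp

theorem circlePow_flow {k : ℕ} (hk : 0 < k) (t : ℝ) (z : Circle) :
    circlePow k (circleFlow k (t, z)) = Complex.exp (2 * Complex.I * t) * circlePow k z := by
  rw [← circlePow_exp hk, circlePow, circleFlow, Circle.coe_mul, mul_pow]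
  rfl

theorem smoothVec_circleField (k : ℕ) : SmoothVec (circleField k) := by
  have h1 : SmoothVec (fun s : ℝ => (tangentModel 𝓘(ℝ, ℝ) s).symm 1) :=
    smoothVec_const (fun x y => rfl) 1
  have h2 := h1.tangentInl (E := EuclideanSpace ℝ (Fin 1)) (N := Circle)
  have h3 := (contMDiff_circleFlow k).contMDiff_tangentMap (m := ∞) (n := ∞) (by simp)
  have h4 : ContMDiff (𝓡 1) (prodModels ℝ (EuclideanSpace ℝ (Fin 1))) ∞
      (fun z : Circle => ((0 : ℝ), z)) := contMDiff_const.prodMk contMDiff_id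
  refine ((h3.comp h2).comp h4).congr fun z => ?_
  have h5 : ∀ (x y : Circle) (_ : x = y) (v : EuclideanSpace ℝ (Fin 1)),
      (⟨y, (tangentModel (𝓡 1) y).symm v⟩ : TangentBundle (𝓡 1) Circle) =
        ⟨x, (tangentModel (𝓡 1) x).symm v⟩ := by
    rintro x _ rfl v
    rfl
  exact h5 _ _ (circleFlow_zero k z) _

theorem mvfderiv_circlePow {k : ℕ} (hk : 0 < k) (z : Circle) :
    mvfderiv (𝓡 1) (circlePow k) z (circleField k z) = 2 * Complex.I * circlePow k z := by
  have h1 : ∀ (x y : Circle) (_ : x = y) (v : TangentSpace (𝓡 1) x),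
      mvfderiv (𝓡 1) (circlePow k) y ((tangentModel (𝓡 1) y).symm (tangentModel (𝓡 1) x v)) =
        mvfderiv (𝓡 1) (circlePow k) x v := by
    rintro x _ rfl v
    rw [ContinuousLinearEquiv.symm_apply_apply]
  have h2 := (contMDiff_circlePow k).mdifferentiable (by simp)
  have h3 := (contMDiff_circleFlow k).mdifferentiable (by simp)
  rw [circleField, h1 _ _ (circleFlow_zero k z)]
  refine (mfderiv_comp_apply (I' := 𝓡 1) ((0 : ℝ), z) (g := circlePow k) (h2 _) (h3 _) _).symm.trans ?_
  refine (mvfderiv_tangentInl (f := circlePow k ∘ circleFlow k) (q := ((0 : ℝ), z))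
    ((h2 _).comp (I' := 𝓡 1) _ (h3 _)) _).trans ?_
  have h4 : (fun s : ℝ => (circlePow k ∘ circleFlow k) (s, z)) =
      fun s : ℝ => Complex.exp (2 * Complex.I * s) * circlePow k z :=
    funext fun s => circlePow_flow hk s z
  rw [h4, mvfderiv, mfderiv_eq_fderiv]
  have h5 := fderiv_mul_const' (contDiff_rotation.differentiable (by simp) (0 : ℝ)) (circlePow k z)
  refine (congr($h5 1)).trans ?_
  rw [smul_apply, fderiv_rotation]
  simp [mul_comm]

theorem isAngularFrame_circle {k : ℕ} (hk : 0 < k) :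
    IsAngularFrame (E' := EuclideanSpace ℝ (Fin 1)) (circlePow k) (circleField k) where
  smooth_w := contMDiff_circlePow k
  conj_mul z := by
    rw [circlePow, map_pow, ← mul_pow, ← Complex.normSq_eq_conj_mul_self]
    simp
  smooth_τ := smoothVec_circleField k
  deriv_τ z := mvfderiv_circlePow hk z
  span z v := by
    have h1 : circleField k z ≠ 0 := fun h0 => by
      have h2 := mvfderiv_circlePow hk z
      rw [h0, map_zero] at h2
      simp [circlePow] at h2
    have h2 : Module.finrank ℝ (TangentSpace (𝓡 1) z) = 1 := finrank_euclideanSpace_fin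
    obtain ⟨a, ha⟩ := (finrank_eq_one_iff_of_nonzero' _ h1).1 h2 v
    exact ⟨a, ha.symm⟩

end CircleFrame

end SasakiLike

end

theorem theorem3p5 (n : ℕ)
    {E : Type*} [NormedAddCommGroup E] [NormedSpace ℝ E] [FiniteDimensional ℝ E]
    (hE : Module.finrank ℝ E = 2 * n)
    {N : Type*} [TopologicalSpace N] [T2Space N] [SecondCountableTopology N]
    [ChartedSpace E N] [IsManifold 𝓘(ℝ, E) ∞ N]
    (J : SasakiLike.EndField 𝓘(ℝ, E) N) (h : SasakiLike.BilinField 𝓘(ℝ, E) N)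
    (hN : SasakiLike.IsHolomorphicComplexRiemannian n J h) :
    SasakiLike.IsSasakiLike n (SasakiLike.solvableExtension J h) ∧
    (CompactSpace N → ∀ k : ℕ, 0 < k →
      CompactSpace (Circle × N) ∧
      ∃ S : SasakiLike.ContactTensors ((𝓡 1).prod 𝓘(ℝ, E)) (Circle × N),
        SasakiLike.DescendsTo (SasakiLike.solvableExtension J h)
          (SasakiLike.circleProj N k) S ∧
        SasakiLike.IsSasakiLike n S) := by
  rw [SasakiLike.solvableExtension_eq]
  refine ⟨SasakiLike.isAngularFrame_halfLine.isSasakiLike hN, fun hc k hk => ⟨inferInstance,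
    SasakiLike.twistedTensors (SasakiLike.circlePow k) (SasakiLike.circleField k) J h,
    SasakiLike.isAngularFrame_halfLine.descendsTo (SasakiLike.isAngularFrame_circle hk)
      (c := fun t : SasakiLike.PosReal => Circle.exp (2 * (t : ℝ) / k)) ?_ ?_ J h,
    (SasakiLike.isAngularFrame_circle hk).isSasakiLike hN⟩⟩
  · have h1 : ContDiff ℝ ∞ (fun s : ℝ => 2 * s / k) :=
      (contDiff_const.mul contDiff_id).div_const _
    exact ((contMDiff_circleExp.comp h1.contMDiff).comp contMDiff_subtype_val).mdifferentiable
      (by simp)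
  · exact fun t => SasakiLike.circlePow_exp hk t
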